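/- Let $G$ be a finite group, $H\le G$ a subgroup and $\alpha$ a finite dimensional orthogonal $G$-representation; write $\alpha$ also for its restriction to $H$. For finite dimensional orthogonal $H$-representations $U,U'$ let $\mathrm{Mor}_H(U,U')$ be the space of all linear isometric embeddings $U\to U'$, with $H$ acting by conjugation; let $\gamma_{H,\alpha}(U,U')\to \mathrm{Mor}_H(U,U')$ be the $H$-vector bundle with total space $\{(f,v): f\in \mathrm{Mor}_H(U,U'),\ v\in\alpha\otimes \mathrm{im}(f)^{\perp}\}$, $S\gamma_{H,\alpha}(U,U')$ its unit sphere bundle, and $\mathrm{Mor}_{H,\alpha}(U,U')$ its Thom space (the one-point compactification of the total space, based at $\infty$). Isometric embeddings $i:U_2\to U_1$ and $j:U_1'\to U_2'$ act by $f\mapsto jfi$ and $(f,v)\mapsto(jfi,(1\otimes j)v)$. Let $\mathcal V^\circ(\alpha)$ be the topological poset of nonzero linear subspaces of $\alpha$ (not necessarily $H$-stable), ordered by inclusion and topologized as a disjoint union of Grassmannians; $H$ acts on it by $V\mapsto hV$. Let $\operatorname{hocolim}_{V\in\mathcal V^\circ(\alpha)}\mathrm{Mor}_H(U\oplus V,U')$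 be the geometric realization of the simplicial space whose $k$-simplices are the chains $V_0\supseteq V_1\supseteq\dots\supseteq V_k$ in $\mathcal V^\circ(\alpha)$ together with a linear isometric embedding $g:U\oplus V_0\to U'$ (topologized as a bundle over the space of chains), with $h\in H$ acting by $((V_r),g)\mapsto ((hV_r),hgh^{-1})$. Restriction to $U$ gives a map $\hat o_\alpha:\operatorname{hocolim}_{V\in\mathcal V^\circ(\alpha)}\mathrm{Mor}_H(U\oplus V,U')\to \mathrm{Mor}_H(U,U')$. Theorem. (1) There are $H$-equivariant homeomorphisms from the unreduced mapping cone of $\hat o_\alpha$ to $\mathrm{Mor}_{H,\alpha}(U,U')$, natural in $U$ and $U'$ with respect to all linear isometric embeddings, which send the cone point to $\infty$ and restrict to the zero section on $\mathrm{Mor}_H(U,U')$. (The cone on the empty space is a point.) (2) There are $H$-equivariant homeomorphisms $$\operatorname{hocolim}_{V\in\mathcal V^\circ(\alpha)}\mathrm{Mor}_H(U\oplus V,U')\;\cong\; S\gamma_{H,\alpha}(U,U'),$$ natural in $U$ and $U'$ with respect to all linear isometric embeddings, under which $\hat o_\alpha$ corresponds to the bundle projection $S\gamma_{H,\alpha}(U,U')\to\mathrm{Mor}_H(U,U')$.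 -/

import Mathlib

open scoped TensorProduct

universe u v w

noncomputable section

namespace StiefelCombinatorics

/-! ### Orthogonal representations and spaces of linear isometric embeddings -/

/-- A finite dimensional orthogonal representation of a group `Γ`: a finite dimensional real
inner product space on which `Γ` acts by linear isometries. -/
structure OrthRep (Γ : Type w) [Group Γ] where
  carrier : Type u
  [normed : NormedAddCommGroup carrier]
  [inner : InnerProductSpace ℝ carrier]
  [finDim : FiniteDimensional ℝ carrier]
  /-- the action of `Γ` by linear isometries -/
  ρ : Γ →* (carrier ≃ₗᵢ[ℝ] carrier)

namespace OrthRep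

variable {Γ : Type w} [Group Γ]

instance : CoeSort (OrthRep.{u} Γ) (Type u) := ⟨OrthRep.carrier⟩

instance (U : OrthRep.{u} Γ) : NormedAddCommGroup U := U.normed
instance (U : OrthRep.{u} Γ) : InnerProductSpace ℝ U := U.inner
instance (U : OrthRep.{u} Γ) : FiniteDimensional ℝ U := U.finDim

/-- Restriction of a representation to a subgroup. -/
def res (α : OrthRep.{u} Γ) (H : Subgroup Γ) : OrthRep.{u} H where
  carrier := α
  ρ := α.ρ.comp H.subtype

end OrthRep

/-- The space of linear isometric embeddings carries the topology of the operator norm. -/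
instance {E : Type u} {F : Type v} [NormedAddCommGroup E] [InnerProductSpace ℝ E]
    [NormedAddCommGroup F] [InnerProductSpace ℝ F] : TopologicalSpace (E →ₗᵢ[ℝ] F) :=
  TopologicalSpace.induced LinearIsometry.toContinuousLinearMap inferInstance

variable {Γ : Type w} [Group Γ]

/-- The space of morphisms `U ⟶ U'` in the category of orthogonal representations: *all* linear
isometric embeddings (a Stiefel manifold), on which `Γ` acts by conjugation. -/
abbrev Mor (U U' : OrthRep.{u} Γ) : Type u := U →ₗᵢ[ℝ] U'

namespace Mor

/-- Functoriality: `f ↦ j ∘ f ∘ i`. -/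
def map {U₁ U₂ U₁' U₂' : OrthRep.{u} Γ} (i : Mor U₂ U₁) (j : Mor U₁' U₂') (f : Mor U₁ U₁') :
    Mor U₂ U₂' :=
  j.comp (f.comp i)

instance (U U' : OrthRep.{u} Γ) : MulAction Γ (Mor U U') where
  smul h f := map (U.ρ h⁻¹).toLinearIsometry (U'.ρ h).toLinearIsometry f
  one_smul f := by
    change map _ _ f = f
    ext x
    simp [map]
  mul_smul g h f := by
    change map _ _ f = map _ _ (map _ _ f)
    ext x
    simp [map]

end Mor

/-! ### The bundle `γ_α(U, U')`, its sphere bundle and its Thom space -/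

/-- The total space of the vector bundle `γ_α(U, U')` over `Mor U U'`: pairs `(f, v)` of a linear
isometric embedding `f : U ⟶ U'` and a vector `v ∈ α ⊗ (im f)ᗮ ⊆ α ⊗ U'`. -/
def Bundle (α : OrthRep.{v} Γ) (U U' : OrthRep.{u} Γ) : Type (max u v) :=
  {x : Mor U U' × (α ⊗[ℝ] U') //
    x.2 ∈ LinearMap.range (LinearMap.lTensor α (LinearMap.range x.1.toLinearMap)ᗮ.subtype)}

instance (α : OrthRep.{v} Γ) (U U' : OrthRep.{u} Γ) : TopologicalSpace (Bundle α U U') :=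
  inferInstanceAs (TopologicalSpace {x : Mor U U' × (α ⊗[ℝ] U') //
    x.2 ∈ LinearMap.range (LinearMap.lTensor α (LinearMap.range x.1.toLinearMap)ᗮ.subtype)})

namespace Bundle

variable {α : OrthRep.{v} Γ} {U₁ U₂ U₁' U₂' : OrthRep.{u} Γ}

/-- The underlying embedding, i.e. the bundle projection. -/
def proj (x : Bundle α U₁ U₁') : Mor U₁ U₁' := x.1.1

/-- The vector in the fibre. -/
def vec (x : Bundle α U₁ U₁') : α ⊗[ℝ] U₁' := x.1.2

/-- The zero section. -/
def zero (f : Mor U₁ U₁') : Bundle α U₁ U₁' := ⟨(f, 0), Submodule.zero_mem _⟩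

theorem map_mem (a : α ≃ₗᵢ[ℝ] α) (i : Mor U₂ U₁) (j : Mor U₁' U₂') (f : Mor U₁ U₁')
    (v : α ⊗[ℝ] U₁')
    (hv : v ∈ LinearMap.range (LinearMap.lTensor α (LinearMap.range f.toLinearMap)ᗮ.subtype)) :
    TensorProduct.map a.toLinearEquiv.toLinearMap j.toLinearMap v ∈ LinearMap.range
      (LinearMap.lTensor α (LinearMap.range (Mor.map i j f).toLinearMap)ᗮ.subtype) := by
  obtain ⟨t, rfl⟩ := hv
  induction t using TensorProduct.induction_on with
  | zero => simp
  | add s t hs ht => rw [map_add, map_add]; exact Submodule.add_mem _ hs ht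
  | tmul b y =>
    have hy : j (y : U₁') ∈ (LinearMap.range (Mor.map i j f).toLinearMap)ᗮ := by
      rw [Submodule.mem_orthogonal]
      rintro _ ⟨z, rfl⟩
      have h := (Submodule.mem_orthogonal _ _).1 y.2 (f (i z)) ⟨i z, rfl⟩
      change inner ℝ (j (f (i z))) (j (y : U₁')) = 0
      rw [LinearIsometry.inner_map_map]
      exact h
    exact ⟨a b ⊗ₜ[ℝ] ⟨j (y : U₁'), hy⟩, by simp⟩

/-- The map `(f, v) ↦ (j ∘ f ∘ i, (a ⊗ j) v)` for an isometry `a` of `α` and linear isometric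
embeddings `i` and `j`. -/
def mapAux (a : α ≃ₗᵢ[ℝ] α) (i : Mor U₂ U₁) (j : Mor U₁' U₂') (x : Bundle α U₁ U₁') :
    Bundle α U₂ U₂' :=
  ⟨(Mor.map i j x.proj, TensorProduct.map a.toLinearEquiv.toLinearMap j.toLinearMap x.vec),
    map_mem a i j x.proj x.vec x.2⟩

theorem ext {x y : Bundle α U₁ U₁'} (h₁ : x.proj = y.proj) (h₂ : x.vec = y.vec) : x = y :=
  Subtype.ext (Prod.ext h₁ h₂)

theorem norm_mapAux (a : α ≃ₗᵢ[ℝ] α) (i : Mor U₂ U₁) (j : Mor U₁' U₂') (x : Bundle α U₁ U₁') :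
    ‖(mapAux a i j x).vec‖ = ‖x.vec‖ :=
  TensorProduct.norm_map a.toLinearIsometry j x.vec

/-- Functoriality: `(f, v) ↦ (j ∘ f ∘ i, (1 ⊗ j) v)`. -/
def map (i : Mor U₂ U₁) (j : Mor U₁' U₂') : Bundle α U₁ U₁' → Bundle α U₂ U₂' :=
  mapAux (LinearIsometryEquiv.refl ℝ α) i j

/-- `Γ` acts by `h • (f, v) = (h f h⁻¹, (h ⊗ h) v)`. -/
instance (U U' : OrthRep.{u} Γ) : MulAction Γ (Bundle α U U') where
  smul h := mapAux (α.ρ h) (U.ρ h⁻¹).toLinearIsometry (U'.ρ h).toLinearIsometry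
  one_smul x := by
    refine ext (one_smul Γ x.proj) ?_
    change TensorProduct.map _ _ x.vec = x.vec
    have : TensorProduct.map (α.ρ 1).toLinearEquiv.toLinearMap
        (U'.ρ 1).toLinearIsometry.toLinearMap = (LinearMap.id : α ⊗[ℝ] U' →ₗ[ℝ] α ⊗[ℝ] U') := by
      refine TensorProduct.ext' fun b y => ?_
      simp
    rw [this]; rfl
  mul_smul g h x := by
    refine ext (mul_smul g h x.proj) ?_
    change TensorProduct.map _ _ x.vec = TensorProduct.map _ _ (TensorProduct.map _ _ x.vec)
    rw [← LinearMap.comp_apply]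
    congr 1
    refine TensorProduct.ext' fun b y => ?_
    simp

theorem norm_smul {U U' : OrthRep.{u} Γ} (h : Γ) (x : Bundle α U U') : ‖(h • x).vec‖ = ‖x.vec‖ :=
  norm_mapAux _ _ _ x

end Bundle

/-- The unit sphere bundle `Sγ_α(U, U')`. -/
def SphereBundle (α : OrthRep.{v} Γ) (U U' : OrthRep.{u} Γ) : Type (max u v) :=
  {x : Bundle α U U' // ‖x.vec‖ = 1}

instance (α : OrthRep.{v} Γ) (U U' : OrthRep.{u} Γ) : TopologicalSpace (SphereBundle α U U') :=
  inferInstanceAs (TopologicalSpace {x : Bundle α U U' // ‖x.vec‖ = 1})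

namespace SphereBundle

variable {α : OrthRep.{v} Γ} {U₁ U₂ U₁' U₂' : OrthRep.{u} Γ}

/-- The bundle projection. -/
def proj (x : SphereBundle α U₁ U₁') : Mor U₁ U₁' := x.1.proj

/-- Functoriality. -/
def map (i : Mor U₂ U₁) (j : Mor U₁' U₂') (x : SphereBundle α U₁ U₁') : SphereBundle α U₂ U₂' :=
  ⟨Bundle.map i j x.1, (Bundle.norm_mapAux _ i j x.1).trans x.2⟩

instance (U U' : OrthRep.{u} Γ) : MulAction Γ (SphereBundle α U U') where
  smul h x := ⟨h • x.1, (Bundle.norm_smul h x.1).trans x.2⟩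
  one_smul x := Subtype.ext (one_smul Γ x.1)
  mul_smul g h x := Subtype.ext (mul_smul g h x.1)

end SphereBundle

/-- The Thom space `Mor_α(U, U')` of the bundle `γ_α(U, U')`. As the base `Mor U U'` is compact,
this is the one-point compactification of the total space. -/
def Thom (α : OrthRep.{v} Γ) (U U' : OrthRep.{u} Γ) : Type (max u v) := OnePoint (Bundle α U U')

instance (α : OrthRep.{v} Γ) (U U' : OrthRep.{u} Γ) : TopologicalSpace (Thom α U U') :=
  inferInstanceAs (TopologicalSpace (OnePoint (Bundle α U U')))

namespace Thom

variable {α : OrthRep.{v} Γ} {U₁ U₂ U₁' U₂' : OrthRep.{u} Γ}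

/-- The base point, i.e. the point at infinity. -/
def pt : Thom α U₁ U₁' := OnePoint.infty

/-- The zero section. -/
def zero (f : Mor U₁ U₁') : Thom α U₁ U₁' := OnePoint.some (Bundle.zero f)

/-- Functoriality. -/
def map (i : Mor U₂ U₁) (j : Mor U₁' U₂') : Thom α U₁ U₁' → Thom α U₂ U₂' :=
  OnePoint.map (Bundle.map i j)

instance (U U' : OrthRep.{u} Γ) : MulAction Γ (Thom α U U') where
  smul h := OnePoint.map (fun x : Bundle α U U' => h • x)
  one_smul x := by
    change OnePoint.map _ x = x
    simp only [one_smul]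
    exact congrFun OnePoint.map_id x
  mul_smul g h x := by
    change OnePoint.map _ x = OnePoint.map _ (OnePoint.map _ x)
    simp only [mul_smul]
    exact congrFun (OnePoint.map_comp (fun x : Bundle α U U' => g • x)
      (fun x : Bundle α U U' => h • x)) x

end Thom

/-! ### The homotopy colimit over the topological poset of nonzero subspaces -/

/-- The poset `𝒱°(α)` of nonzero linear subspaces of `α` (not only the `Γ`-stable ones), ordered
by inclusion. -/
abbrev NZSub (α : OrthRep.{v} Γ) : Type v := {V : Submodule ℝ α // V ≠ ⊥}

namespace NZSub

variable {α : OrthRep.{v} Γ}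

/-- The image of a nonzero subspace under an isometry. -/
def map (a : α ≃ₗᵢ[ℝ] α) (V : NZSub α) : NZSub α :=
  ⟨V.1.map a.toLinearEquiv.toLinearMap, fun h => V.2 (Submodule.map_eq_bot_iff.1 h)⟩

/-- The isometry `a V ≅ V` given by `a⁻¹`. -/
def back (a : α ≃ₗᵢ[ℝ] α) (V : NZSub α) : (NZSub.map a V).1 →ₗᵢ[ℝ] V.1 :=
  (a.submoduleMap V.1).symm.toLinearIsometry

theorem coe_back (a : α ≃ₗᵢ[ℝ] α) (V : NZSub α) (y : (NZSub.map a V).1) :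
    ((NZSub.back a V y : V.1) : α) = a.symm y := by
  obtain ⟨z, rfl⟩ := (a.submoduleMap V.1).surjective y
  have h₁ : NZSub.back a V (a.submoduleMap V.1 z) = z := (a.submoduleMap V.1).symm_apply_apply z
  rw [h₁]
  exact (a.symm_apply_apply (z : α)).symm

theorem map_one (V : NZSub α) : NZSub.map (α.ρ 1) V = V := by
  refine Subtype.ext ?_
  have : (α.ρ 1).toLinearEquiv.toLinearMap = LinearMap.id := by ext x; simp
  change V.1.map _ = V.1
  rw [this, Submodule.map_id]

theorem map_mul (g h : Γ) (V : NZSub α) :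
    NZSub.map (α.ρ (g * h)) V = NZSub.map (α.ρ g) (NZSub.map (α.ρ h) V) := by
  refine Subtype.ext ?_
  have : (α.ρ (g * h)).toLinearEquiv.toLinearMap =
      (α.ρ g).toLinearEquiv.toLinearMap ∘ₗ (α.ρ h).toLinearEquiv.toLinearMap := by ext x; simp
  change V.1.map _ = (V.1.map _).map _
  rw [this, Submodule.map_comp]

end NZSub

/-- The inclusion of subspaces as a linear isometry. -/
def inclusion {E : Type v} [NormedAddCommGroup E] [InnerProductSpace ℝ E] {V W : Submodule ℝ E}
    (h : V ≤ W) : V →ₗᵢ[ℝ] W :=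
  ⟨Submodule.inclusion h, fun _ => rfl⟩

/-- The orthogonal direct sum `U ⊕ V` for a linear subspace `V` of `α`. -/
abbrev DirectSum (U : OrthRep.{u} Γ) {α : OrthRep.{v} Γ} (V : Submodule ℝ α) : Type (max u v) :=
  WithLp 2 (U × V)

/-- The extension by zero of a linear isometric embedding `g : U ⊕ V → U'` to `U ⊕ α`, that is,
`(x, y) ↦ g (x, P_V y)` with `P_V` the orthogonal projection to `V`. -/
def extend {α : OrthRep.{v} Γ} {U U' : OrthRep.{u} Γ} (V : Submodule ℝ α)
    (g : DirectSum U V →ₗᵢ[ℝ] U') : WithLp 2 (U × α) →L[ℝ] U' :=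
  g.toContinuousLinearMap ∘L
    ((WithLp.prodContinuousLinearEquiv 2 ℝ U V).symm.toContinuousLinearMap ∘L
      (((ContinuousLinearMap.id ℝ U).prodMap V.orthogonalProjectionOnto) ∘L
        (WithLp.prodContinuousLinearEquiv 2 ℝ U α).toContinuousLinearMap))

/-- A `k`-simplex of the bar construction of the contravariant functor `V ↦ Mor (U ⊕ V, U')` on
`𝒱°(α)`: a chain `V₀ ⊇ V₁ ⊇ ⋯ ⊇ V_k` of nonzero linear subspaces of `α`, and a linear isometric
embedding `U ⊕ V₀ → U'`. -/
structure BarSimplex (α : OrthRep.{v} Γ) (U U' : OrthRep.{u} Γ) (k : ℕ) where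
  chain : Fin (k + 1) → NZSub α
  anti : Antitone chain
  emb : DirectSum U (chain 0).1 →ₗᵢ[ℝ] U'

namespace BarSimplex

variable {α : OrthRep.{v} Γ} {U U' U₁ U₂ U₁' U₂' : OrthRep.{u} Γ} {k m : ℕ}

/-- The space of `k`-simplices. Subspaces are topologized through their orthogonal projections
(the usual topology of Grassmannians), and the embeddings `U ⊕ V₀ → U'`, as `V₀` varies, through
their extensions by zero. -/
instance : TopologicalSpace (BarSimplex α U U' k) :=
  TopologicalSpace.induced
    (fun σ => ((fun i => (σ.chain i).1.starProjection : Fin (k + 1) → (α →L[ℝ] α)),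
      extend (σ.chain 0).1 σ.emb))
    inferInstance

theorem ext' {σ τ : BarSimplex α U U' k} (hc : σ.chain = τ.chain)
    (hg : ∀ (x : U) (y : α) (h₁ : y ∈ (σ.chain 0).1) (h₂ : y ∈ (τ.chain 0).1),
      σ.emb (WithLp.toLp 2 (x, ⟨y, h₁⟩)) = τ.emb (WithLp.toLp 2 (x, ⟨y, h₂⟩))) : σ = τ := by
  obtain ⟨c, hcA, g⟩ := σ
  obtain ⟨d, hdA, g'⟩ := τ
  dsimp only at hc hg
  subst hc
  congr 1
  ext z
  exact hg z.fst z.snd.1 z.snd.2 z.snd.2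

/-- The simplicial structure: pull back the chain along an order preserving map `θ` and restrict
the embedding along the inclusion `V_{θ 0} ⊆ V₀`. -/
def reindex (θ : Fin (m + 1) →o Fin (k + 1)) (σ : BarSimplex α U U' k) : BarSimplex α U U' m where
  chain i := σ.chain (θ i)
  anti _ _ h := σ.anti (θ.monotone h)
  emb := σ.emb.comp (LinearIsometry.withLpProdMap 2 LinearIsometry.id
    (inclusion (σ.anti (Fin.zero_le (θ 0)))))

/-- The map `((V_r), g) ↦ ((a V_r), j ∘ g ∘ (i ⊕ a⁻¹))`. -/
def mapAux (a : α ≃ₗᵢ[ℝ] α) (i : Mor U₂ U₁) (j : Mor U₁' U₂') (σ : BarSimplex α U₁ U₁' k) :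
    BarSimplex α U₂ U₂' k where
  chain r := NZSub.map a (σ.chain r)
  anti _ _ h := Submodule.map_mono (σ.anti h)
  emb := j.comp (σ.emb.comp (LinearIsometry.withLpProdMap 2 i (NZSub.back a (σ.chain 0))))

theorem reindex_mapAux (a : α ≃ₗᵢ[ℝ] α) (i : Mor U₂ U₁) (j : Mor U₁' U₂')
    (θ : Fin (m + 1) →o Fin (k + 1)) (σ : BarSimplex α U₁ U₁' k) :
    (σ.mapAux a i j).reindex θ = (σ.reindex θ).mapAux a i j := rfl

instance : MulAction Γ (BarSimplex α U U' k) where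
  smul h := mapAux (α.ρ h) (U.ρ h⁻¹).toLinearIsometry (U'.ρ h).toLinearIsometry
  one_smul σ := by
    refine ext' (funext fun r => NZSub.map_one _) fun x y h₁ h₂ => ?_
    change U'.ρ 1 (σ.emb (WithLp.toLp 2 (U.ρ 1⁻¹ x, NZSub.back (α.ρ 1) (σ.chain 0) ⟨y, h₁⟩))) = _
    have : NZSub.back (α.ρ 1) (σ.chain 0) ⟨y, h₁⟩ = ⟨y, h₂⟩ :=
      Subtype.ext ((NZSub.coe_back _ _ _).trans (LinearIsometryEquiv.congr_fun (congrArg LinearIsometryEquiv.symm α.ρ.map_one) y))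
    rw [this]
    simp
  mul_smul g h σ := by
    refine ext' (funext fun r => NZSub.map_mul g h _) fun x y h₁ h₂ => ?_
    change U'.ρ (g * h) (σ.emb (WithLp.toLp 2
        (U.ρ (g * h)⁻¹ x, NZSub.back (α.ρ (g * h)) (σ.chain 0) ⟨y, h₁⟩))) =
      U'.ρ g (U'.ρ h (σ.emb (WithLp.toLp 2 (U.ρ h⁻¹ (U.ρ g⁻¹ x), NZSub.back (α.ρ h) (σ.chain 0)
        (NZSub.back (α.ρ g) (NZSub.map (α.ρ h) (σ.chain 0)) ⟨y, h₂⟩)))))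
    have : NZSub.back (α.ρ (g * h)) (σ.chain 0) ⟨y, h₁⟩ = NZSub.back (α.ρ h) (σ.chain 0)
        (NZSub.back (α.ρ g) (NZSub.map (α.ρ h) (σ.chain 0)) ⟨y, h₂⟩) := by
      refine Subtype.ext ?_
      rw [NZSub.coe_back, NZSub.coe_back, NZSub.coe_back]
      exact LinearIsometryEquiv.congr_fun
        (congrArg LinearIsometryEquiv.symm (α.ρ.map_mul g h)) y
    rw [this]
    simp

end BarSimplex

/-- The identifications in the geometric realization: `(θ* σ, p) ∼ (σ, θ_* p)` for every order
preserving map `θ` (faces and degeneracies). -/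
inductive RealizationRel (α : OrthRep.{v} Γ) (U U' : OrthRep.{u} Γ) :
    (Σ k : ℕ, BarSimplex α U U' k × stdSimplex ℝ (Fin (k + 1))) →
    (Σ k : ℕ, BarSimplex α U U' k × stdSimplex ℝ (Fin (k + 1))) → Prop
  | glue {m k : ℕ} (θ : Fin (m + 1) →o Fin (k + 1)) (σ : BarSimplex α U U' k)
      (p : stdSimplex ℝ (Fin (m + 1))) :
      RealizationRel α U U' ⟨m, σ.reindex θ, p⟩ ⟨k, σ, stdSimplex.map θ p⟩

/-- The homotopy colimit `hocolim_{V ∈ 𝒱°(α)} Mor (U ⊕ V, U')`: the geometric realization of the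
bar construction, with the quotient topology from `∐ₖ (k-simplices) × Δᵏ`. -/
def Hocolim (α : OrthRep.{v} Γ) (U U' : OrthRep.{u} Γ) : Type (max u v) :=
  Quot (RealizationRel α U U')

instance (α : OrthRep.{v} Γ) (U U' : OrthRep.{u} Γ) : TopologicalSpace (Hocolim α U U') :=
  inferInstanceAs (TopologicalSpace (Quot (RealizationRel α U U')))

namespace Hocolim

variable {α : OrthRep.{v} Γ} {U₁ U₂ U₁' U₂' : OrthRep.{u} Γ}

/-- The map of homotopy colimits induced by an isometry `a` of `α` and linear isometric embeddings
`i` and `j`. -/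
def mapAux (a : α ≃ₗᵢ[ℝ] α) (i : Mor U₂ U₁) (j : Mor U₁' U₂') :
    Hocolim α U₁ U₁' → Hocolim α U₂ U₂' :=
  Quot.map (fun x => ⟨x.1, x.2.1.mapAux a i j, x.2.2⟩) (by
    rintro _ _ ⟨θ, σ, p⟩
    exact RealizationRel.glue θ (σ.mapAux a i j) p)

/-- Functoriality: composition of the embeddings `U₁ ⊕ V → U₁'` with `j` and `i ⊕ 1`. -/
def map (i : Mor U₂ U₁) (j : Mor U₁' U₂') : Hocolim α U₁ U₁' → Hocolim α U₂ U₂' :=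
  mapAux (LinearIsometryEquiv.refl ℝ α) i j

/-- The action of `Γ`, which permutes the subspaces `V` of `α` and sends `g : U ⊕ V → U'` to
`h g h⁻¹ : U ⊕ h V → U'`. -/
instance (U U' : OrthRep.{u} Γ) : MulAction Γ (Hocolim α U U') where
  smul h := mapAux (α.ρ h) (U.ρ h⁻¹).toLinearIsometry (U'.ρ h).toLinearIsometry
  one_smul x := by
    obtain ⟨k, σ, p⟩ := x
    exact congrArg (fun τ => Quot.mk (RealizationRel α U U') ⟨k, τ, p⟩) (one_smul Γ σ)
  mul_smul g h x := by
    obtain ⟨k, σ, p⟩ := x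
    exact congrArg (fun τ => Quot.mk (RealizationRel α U U') ⟨k, τ, p⟩) (mul_smul g h σ)

/-- The canonical map `hocolim_V Mor (U ⊕ V, U') → Mor (U, U')`, given by restriction to `U`. -/
def toMor : Hocolim α U₁ U₁' → Mor U₁ U₁' :=
  Quot.lift (fun x =>
    { toFun := fun u => x.2.1.emb (WithLp.toLp 2 (u, 0))
      map_add' := fun u u' => by
        rw [← _root_.map_add, ← WithLp.toLp_add, Prod.mk_add_mk, add_zero]
      map_smul' := fun c u => by
        rw [RingHom.id_apply, ← _root_.map_smul, ← WithLp.toLp_smul, Prod.smul_mk, smul_zero]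
      norm_map' := fun u => by
        change ‖x.2.1.emb (WithLp.toLp 2 (u, 0))‖ = ‖u‖
        rw [LinearIsometry.norm_map]
        simp }) (by
    rintro _ _ ⟨θ, σ, p⟩
    ext u
    change σ.emb (WithLp.toLp 2 (u, inclusion (σ.anti (Fin.zero_le (θ 0))) 0)) =
      σ.emb (WithLp.toLp 2 (u, 0))
    rw [_root_.map_zero])

theorem toMor_mapAux (a : α ≃ₗᵢ[ℝ] α) (i : Mor U₂ U₁) (j : Mor U₁' U₂') (x : Hocolim α U₁ U₁') :
    (mapAux a i j x).toMor = Mor.map i j x.toMor := by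
  obtain ⟨k, σ, p⟩ := x
  ext u
  change j (σ.emb (WithLp.toLp 2 (i u, NZSub.back a (σ.chain 0) 0))) =
    j (σ.emb (WithLp.toLp 2 (i u, 0)))
  rw [_root_.map_zero]

end Hocolim

/-! ### The unreduced mapping cone -/

section Cone

variable {X : Type v} {Y : Type u} {X' : Type v} {Y' : Type u}

/-- The identifications `(x, 0) ∼ *` and `(x, 1) ∼ f x` on `{*} ⊔ (X × [0,1]) ⊔ Y`. -/
inductive ConeRel (f : X → Y) :
    Unit ⊕ (X × unitInterval) ⊕ Y → Unit ⊕ (X × unitInterval) ⊕ Y → Prop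
  | apex (x : X) : ConeRel f (.inr (.inl (x, 0))) (.inl ())
  | base (x : X) : ConeRel f (.inr (.inl (x, 1))) (.inr (.inr (f x)))

/-- The unreduced mapping cone (unreduced cofiber) of `f : X → Y`. The cone on the empty space is
a point, so the cofiber of `∅ → Y` is `Y` with a disjoint base point. -/
def Cofiber (f : X → Y) : Type (max u v) := Quot (ConeRel f)

instance [TopologicalSpace X] [TopologicalSpace Y] (f : X → Y) : TopologicalSpace (Cofiber f) :=
  inferInstanceAs (TopologicalSpace (Quot (ConeRel f)))

namespace Cofiber

/-- The base point, i.e. the cone point. -/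
def pt {f : X → Y} : Cofiber f := Quot.mk _ (.inl ())

/-- The inclusion of the target. -/
def incl {f : X → Y} (y : Y) : Cofiber f := Quot.mk _ (.inr (.inr y))

/-- The map of mapping cones induced by a commutative square. -/
def map {f : X → Y} {f' : X' → Y'} (p : X → X') (q : Y → Y') (h : ∀ x, f' (p x) = q (f x)) :
    Cofiber f → Cofiber f' :=
  Quot.map (Sum.map id (Sum.map (Prod.map p id) q)) (by
    rintro _ _ (x | x)
    · exact ConeRel.apex (p x)
    · have := ConeRel.base (f := f') (p x)
      rw [h] at this
      exact this)

end Cofiber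

end Cone

/-- The unreduced cofiber of `hocolim_{V ∈ 𝒱°(α)} Mor (U ⊕ V, U') → Mor (U, U')`. -/
def StiefelCofiber (α : OrthRep.{v} Γ) (U U' : OrthRep.{u} Γ) : Type (max u v) :=
  Cofiber (Hocolim.toMor : Hocolim α U U' → Mor U U')

instance (α : OrthRep.{v} Γ) (U U' : OrthRep.{u} Γ) : TopologicalSpace (StiefelCofiber α U U') :=
  inferInstanceAs (TopologicalSpace (Cofiber (Hocolim.toMor : Hocolim α U U' → Mor U U')))

namespace StiefelCofiber

variable {α : OrthRep.{v} Γ} {U₁ U₂ U₁' U₂' : OrthRep.{u} Γ}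

/-- The base point, i.e. the cone point. -/
def pt : StiefelCofiber α U₁ U₁' := Cofiber.pt

/-- The inclusion of `Mor (U, U')`. -/
def incl (f : Mor U₁ U₁') : StiefelCofiber α U₁ U₁' := Cofiber.incl f

/-- Functoriality. -/
def map (i : Mor U₂ U₁) (j : Mor U₁' U₂') : StiefelCofiber α U₁ U₁' → StiefelCofiber α U₂ U₂' :=
  Cofiber.map (Hocolim.map i j) (Mor.map i j) (Hocolim.toMor_mapAux _ i j)

theorem toMor_smul {U U' : OrthRep.{u} Γ} (h : Γ) (x : Hocolim α U U') :
    (h • x).toMor = h • x.toMor :=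
  Hocolim.toMor_mapAux _ _ _ x

/-- `Γ` acts on `Mor (U, U')` and on the homotopy colimit, and fixes the cone coordinate. -/
instance (U U' : OrthRep.{u} Γ) : MulAction Γ (StiefelCofiber α U U') where
  smul h := Cofiber.map (fun x => h • x) (fun f => h • f) (toMor_smul h)
  one_smul x := by
    obtain ⟨_ | ⟨x, t⟩ | f⟩ := x
    · rfl
    · exact congrArg (fun y => Quot.mk (ConeRel Hocolim.toMor) (Sum.inr (Sum.inl (y, t)))) (one_smul Γ x)
    · exact congrArg (fun y => Quot.mk (ConeRel Hocolim.toMor) (Sum.inr (Sum.inr y))) (one_smul Γ f)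
  mul_smul g h x := by
    obtain ⟨_ | ⟨x, t⟩ | f⟩ := x
    · rfl
    · exact congrArg (fun y => Quot.mk (ConeRel Hocolim.toMor) (Sum.inr (Sum.inl (y, t)))) (mul_smul g h x)
    · exact congrArg (fun y => Quot.mk (ConeRel Hocolim.toMor) (Sum.inr (Sum.inr y))) (mul_smul g h f)

end StiefelCofiber

end StiefelCombinatorics

end

noncomputable section

namespace StiefelCombinatorics

variable {Γ : Type w} [Group Γ]

/-! ### Tensors as operators -/

/-! A tensor in `α ⊗ U'` is the same thing as an operator `A : α → U'`, and lying in the fibre over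
`f` means that `A` takes values in the complement of `im f`. A point of the homotopy colimit is a
flag `V₀ ⊇ ⋯ ⊇ V_k` with barycentric coordinates `p` and an isometric embedding `g` of `U ⊕ V₀`. It
yields `f = g|U` and `A = g|V₀ ∘ S`, where `S = ∑ pᵢ P_{Vᵢ}`. This has operator norm one, and
rescaling it to tensor norm one gives a point of the sphere bundle.

The inverse is the polar decomposition. Since `g` is isometric, `A* A = S²`, so `A` determines `S`
(`eq_of_sq_eq`). The operator `S` determines the subspaces of positive weight together with their
weights (`weightOp_injOn`), and `g` is recovered on `V₀ = range S` from `g (S z) = A z` once zero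
weights are discarded. Conversely, the spectral decomposition of `√(A* A)` writes any nonzero `A` in
this form, the weights being the differences of consecutive singular values
(`exists_flag_decomposition`).

The resulting bijection is continuous, its target is Hausdorff, and its source is compact because
strictly decreasing flags have bounded length; so it is a homeomorphism. For the mapping cone, the
cone coordinate `t` becomes the radius `(1 - t) / t`, and the same compactness argument applies. All
constructions commute with isometries of `α` and with composition by isometric embeddings, which
gives equivariance and naturality together. -/

section TensorHom

variable {E : Type v} {F : Type u} [NormedAddCommGroup E] [InnerProductSpace ℝ E]
  [NormedAddCommGroup F] [InnerProductSpace ℝ F]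

/-- The operator `x ↦ ⟪a, x⟫ • y` attached to the tensor `a ⊗ y`. -/
def tensorToHom (E : Type v) (F : Type u) [NormedAddCommGroup E] [InnerProductSpace ℝ E]
    [NormedAddCommGroup F] [InnerProductSpace ℝ F] : E ⊗[ℝ] F →ₗ[ℝ] (E →L[ℝ] F) :=
  TensorProduct.lift (LinearMap.mk₂ ℝ (fun a y => (innerSL ℝ a).smulRight y)
    (fun a b y => by ext x; simp [add_smul])
    (fun c a y => by ext x; simp [mul_smul])
    (fun a y z => by ext x; simp)
    (fun c a y => by ext x; exact smul_comm _ _ _))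

@[simp]
theorem tensorToHom_tmul (a : E) (y : F) (x : E) :
    tensorToHom E F (a ⊗ₜ[ℝ] y) x = inner ℝ a x • y := by
  simp [tensorToHom]

variable [FiniteDimensional ℝ E]

/-- The correspondence between tensors in `E ⊗ F` and operators `E → F`. -/
def tensorHom (E : Type v) (F : Type u) [NormedAddCommGroup E] [InnerProductSpace ℝ E]
    [NormedAddCommGroup F] [InnerProductSpace ℝ F] [FiniteDimensional ℝ E] :
    E ⊗[ℝ] F ≃ₗ[ℝ] (E →L[ℝ] F) :=
  LinearEquiv.ofLinearMap (tensorToHom E F)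
    { toFun := fun A => ∑ i, (stdOrthonormalBasis ℝ E i : E) ⊗ₜ[ℝ] A (stdOrthonormalBasis ℝ E i)
      map_add' := fun A B => by simp [TensorProduct.tmul_add, Finset.sum_add_distrib]
      map_smul' := fun c A => by simp [Finset.smul_sum] }
    (by
      ext A x
      change tensorToHom E F (∑ i, (stdOrthonormalBasis ℝ E i : E) ⊗ₜ[ℝ]
        A (stdOrthonormalBasis ℝ E i)) x = A x
      rw [map_sum, sum_apply]
      simp only [tensorToHom_tmul]
      conv_rhs => rw [← (stdOrthonormalBasis ℝ E).sum_repr' x]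
      simp)
    (by
      refine TensorProduct.ext' fun a y => ?_
      change ∑ i, (stdOrthonormalBasis ℝ E i : E) ⊗ₜ[ℝ]
        tensorToHom E F (a ⊗ₜ[ℝ] y) (stdOrthonormalBasis ℝ E i) = a ⊗ₜ[ℝ] y
      simp only [tensorToHom_tmul, ← TensorProduct.smul_tmul]
      rw [← TensorProduct.sum_tmul]
      congr 1
      conv_rhs => rw [← (stdOrthonormalBasis ℝ E).sum_repr' a]
      simp [real_inner_comm])

@[simp]
theorem tensorHom_tmul (a : E) (y : F) (x : E) :
    tensorHom E F (a ⊗ₜ[ℝ] y) x = inner ℝ a x • y :=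
  tensorToHom_tmul a y x

/-- The adjoint of the isometry `a` is its inverse, so `a ⊗ j` acts on operators by `A ↦ j A a⁻¹`.
-/
theorem tensorHom_map {E' : Type v} {F' : Type u} [NormedAddCommGroup E']
    [InnerProductSpace ℝ E'] [FiniteDimensional ℝ E'] [NormedAddCommGroup F']
    [InnerProductSpace ℝ F'] (a : E ≃ₗᵢ[ℝ] E') (j : F →ₗ[ℝ] F') (v : E ⊗[ℝ] F) (x : E') :
    tensorHom E' F' (TensorProduct.map a.toLinearEquiv.toLinearMap j v) x =
      j (tensorHom E F v (a.symm x)) := by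
  induction v using TensorProduct.induction_on with
  | zero => simp
  | add s t hs ht => simp [hs, ht]
  | tmul b y =>
    have : inner ℝ (a b) x = inner ℝ b (a.symm x) := by
      rw [← a.inner_map_map b, a.apply_symm_apply]
    simp [this]

/-- The correspondence is compatible with `W ⊆ F`, so the fibre condition on tensors can be checked
on the values of the operator. -/
theorem mem_range_lTensor_iff (W : Submodule ℝ F) (v : E ⊗[ℝ] F) :
    v ∈ LinearMap.range (LinearMap.lTensor E W.subtype) ↔ ∀ x, tensorHom E F v x ∈ W := by
  have key : ∀ (t : E ⊗[ℝ] W) (x : E),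
      tensorHom E F (LinearMap.lTensor E W.subtype t) x = tensorHom E W t x := by
    intro t x
    induction t using TensorProduct.induction_on with
    | zero => simp
    | add s t hs ht => simp [hs, ht]
    | tmul b y => simp
  constructor
  · rintro ⟨t, rfl⟩ x
    rw [key]
    exact (tensorHom E W t x).2
  · intro h
    refine ⟨(tensorHom E W).symm ((tensorHom E F v).codRestrict W h), ?_⟩
    apply (tensorHom E F).injective
    ext x
    rw [key, LinearEquiv.apply_symm_apply]
    rfl

end TensorHom

/-! ### Weighted sums of orthogonal projections -/

section Projections

variable {E : Type v} [NormedAddCommGroup E] [InnerProductSpace ℝ E] [FiniteDimensional ℝ E]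

/-- A nonnegative symmetric operator is determined by its square. -/
theorem eq_of_sq_eq {S T : E →L[ℝ] E} (hS : S.toLinearMap.IsSymmetric)
    (hT : T.toLinearMap.IsSymmetric) (hT0 : ∀ x, 0 ≤ inner ℝ (T x) x)
    (hS0 : ∀ x, 0 ≤ inner ℝ (S x) x) (h : ∀ x, S (S x) = T (T x)) : S = T := by
  have hb : ∀ i, S (hS.eigenvectorBasis rfl i) = T (hS.eigenvectorBasis rfl i) := by
    intro i
    set e := hS.eigenvectorBasis rfl i with he
    set s := hS.eigenvalues rfl i
    have hSe : S e = s • e := hS.apply_eigenvectorBasis rfl i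
    have hs : 0 ≤ s := by
      have := hS0 e
      rw [hSe, inner_smul_left, he, real_inner_self_eq_norm_sq,
        (hS.eigenvectorBasis rfl).norm_eq_one] at this
      simpa using this
    have h2 : T (T e) = (s * s) • e := by rw [← h, hSe, map_smul, hSe, smul_smul]
    rw [hSe, eq_comm, ← sub_eq_zero]
    -- From `T² e = s² e` one gets `(T + s) z = 0`. For `s > 0` a nonzero `z` would be an
    -- eigenvector of `T` with negative eigenvalue; for `s = 0` use `‖T e‖² = ⟪T² e, e⟫ = 0`.
    set z := T e - s • e with hz
    have hTz : T z = -(s • z) := by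
      rw [hz, map_sub, h2, map_smul, smul_sub, smul_smul]; abel
    rcases hs.eq_or_lt with h0 | h0
    · have hz' : z = T e := by rw [hz, ← h0, zero_smul, sub_zero]
      rw [hz', ← @inner_self_eq_zero ℝ]
      have : inner ℝ (T e) (T e) = inner ℝ (T (T e)) e := (hT _ _).symm
      rw [this, h2, ← h0]; simp
    · have := hT0 z
      rw [hTz, inner_neg_left, inner_smul_left, real_inner_self_eq_norm_sq] at this
      have h3 : 0 ≤ ‖z‖ ^ 2 := sq_nonneg _
      have h4 : s * ‖z‖ ^ 2 ≤ 0 := by simpa using this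
      have h5 : ‖z‖ ^ 2 = 0 := by nlinarith
      simpa using h5
  have : S.toLinearMap = T.toLinearMap :=
    (hS.eigenvectorBasis rfl).toBasis.ext fun i => by
      rw [OrthonormalBasis.coe_toBasis]; exact hb i
  exact ContinuousLinearMap.coe_injective this

/-- The operator `∑ c V • P_V` attached to a finitely supported weight on subspaces. -/
def weightOp (E : Type v) [NormedAddCommGroup E] [InnerProductSpace ℝ E]
    [FiniteDimensional ℝ E] : (Submodule ℝ E →₀ ℝ) →ₗ[ℝ] (E →L[ℝ] E) :=
  Finsupp.linearCombination ℝ (fun V => V.starProjection)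

theorem weightOp_apply (c : Submodule ℝ E →₀ ℝ) (x : E) :
    weightOp E c x = ∑ V ∈ c.support, c V • V.starProjection x := by
  simp [weightOp, Finsupp.linearCombination_apply, Finsupp.sum]

theorem inner_weightOp_self (c : Submodule ℝ E →₀ ℝ) (x : E) :
    inner ℝ (weightOp E c x) x = ∑ V ∈ c.support, c V * ‖V.starProjection x‖ ^ 2 := by
  rw [weightOp_apply, sum_inner]
  refine Finset.sum_congr rfl fun V _ => ?_
  rw [inner_smul_left]
  exact congrArg (c V * ·) (V.re_inner_starProjection_eq_normSq x)

theorem weightOp_isSymmetric (c : Submodule ℝ E →₀ ℝ) :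
    (weightOp E c).toLinearMap.IsSymmetric := by
  intro x y
  change inner ℝ (weightOp E c x) y = inner ℝ x (weightOp E c y)
  rw [weightOp_apply, weightOp_apply, sum_inner, inner_sum]
  refine Finset.sum_congr rfl fun V _ => ?_
  rw [inner_smul_left, inner_smul_right, Submodule.inner_starProjection_left_eq_right]
  simp

/-- If `S x = 0` then `⟪S x, x⟫ = ∑ c V ‖P_V x‖²` vanishes, and so does each of its nonnegative
terms. -/
theorem weightOp_apply_eq_zero_iff {c : Submodule ℝ E →₀ ℝ} (hc : ∀ V, 0 ≤ c V) (x : E) :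
    weightOp E c x = 0 ↔ ∀ V ∈ c.support, x ∈ Vᗮ := by
  constructor
  · intro h V hV
    have h1 := inner_weightOp_self c x
    rw [h, inner_zero_left, eq_comm, Finset.sum_eq_zero_iff_of_nonneg
      fun V _ => mul_nonneg (hc V) (sq_nonneg _)] at h1
    have h2 := h1 V hV
    have h3 : c V ≠ 0 := Finsupp.mem_support_iff.1 hV
    rw [← Submodule.starProjection_apply_eq_zero_iff]
    simpa [h3] using h2
  · intro h
    rw [weightOp_apply]
    refine Finset.sum_eq_zero fun V hV => ?_
    rw [(Submodule.starProjection_apply_eq_zero_iff _).2 (h V hV), smul_zero]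

/-- A finite nonempty chain of subspaces that is the support of a weight has a largest element, the
orthogonal complement of the kernel. -/
theorem exists_mem_support_ker {c : Submodule ℝ E →₀ ℝ} (hc : ∀ V, 0 ≤ c V)
    (hch : IsChain (· ≤ ·) (c.support : Set (Submodule ℝ E))) (hne : c ≠ 0) :
    (LinearMap.ker (weightOp E c).toLinearMap)ᗮ ∈ c.support := by
  obtain ⟨V, hV, hmax⟩ : ∃ V ∈ c.support, ∀ W ∈ c.support, W ≤ V := by
    obtain ⟨V, hV⟩ := c.support.exists_maximal (Finsupp.support_nonempty_iff.2 hne)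
    refine ⟨V, hV.1, fun W hW => ?_⟩
    rcases hch.total hW hV.1 with h | h
    · exact h
    · exact hV.2 hW h
  convert hV
  rw [← Submodule.orthogonal_orthogonal V]
  congr 1
  ext x
  rw [LinearMap.mem_ker]
  refine (weightOp_apply_eq_zero_iff hc x).trans ⟨fun h => h V hV, fun h W hW => ?_⟩
  exact Submodule.orthogonal_le (hmax W hW) h

/-- A nonnegative weight supported on a chain of nonzero subspaces is determined by its
operator. -/
theorem weightOp_injOn (c d : Submodule ℝ E →₀ ℝ) (hc : ∀ V, 0 ≤ c V) (hd : ∀ V, 0 ≤ d V)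
    (hcc : IsChain (· ≤ ·) (c.support : Set (Submodule ℝ E)))
    (hdc : IsChain (· ≤ ·) (d.support : Set (Submodule ℝ E))) (hc0 : c ⊥ = 0) (hd0 : d ⊥ = 0)
    (h : weightOp E c = weightOp E d) : c = d := by
  -- Both supports have the same largest member, namely the complement of the common kernel.
  -- Subtracting the smaller of the two coefficients there removes it from at least one support.
  induction hn : c.support.card + d.support.card using Nat.strong_induction_on
    generalizing c d with
  | _ n ih =>
  have aux : ∀ e : Submodule ℝ E →₀ ℝ, (∀ V, 0 ≤ e V) → e ⊥ = 0 → weightOp E e = 0 → e = 0 := by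
    intro e he he0 h0
    by_contra hne
    obtain ⟨V, hV⟩ := Finsupp.support_nonempty_iff.2 hne
    have : V = ⊥ := by
      rw [← Submodule.orthogonal_eq_top_iff, eq_top_iff]
      intro x _
      exact (weightOp_apply_eq_zero_iff he x).1 (by rw [h0]; rfl) V hV
    rw [this, Finsupp.mem_support_iff] at hV
    exact hV he0
  by_cases hcz : c = 0
  · subst hcz
    exact (aux d hd hd0 (by rw [← h, map_zero])).symm
  by_cases hdz : d = 0
  · subst hdz
    exact aux c hc hc0 (by rw [h, map_zero])
  have hcV := exists_mem_support_ker hc hcc hcz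
  have hdV := exists_mem_support_ker hd hdc hdz
  rw [← h] at hdV
  set V := (LinearMap.ker (weightOp E c).toLinearMap)ᗮ
  have hcp : 0 < c V := (hc V).lt_of_ne' (Finsupp.mem_support_iff.1 hcV)
  have hdp : 0 < d V := (hd V).lt_of_ne' (Finsupp.mem_support_iff.1 hdV)
  set m := min (c V) (d V)
  have hm : 0 < m := lt_min hcp hdp
  have hsub : ∀ e : Submodule ℝ E →₀ ℝ, V ∈ e.support →
      (e - Finsupp.single V m).support ⊆ e.support := by
    intro e heV W hW
    by_cases hWV : W = V
    · rwa [hWV]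
    · rw [Finsupp.mem_support_iff] at hW ⊢
      simpa [Finsupp.single_apply, Ne.symm hWV] using hW
  have hnn : ∀ e : Submodule ℝ E →₀ ℝ, (∀ W, 0 ≤ e W) → m ≤ e V →
      ∀ W, 0 ≤ (e - Finsupp.single V m) W := by
    intro e he hmV W
    by_cases hWV : W = V
    · subst hWV; simpa using hmV
    · simpa [Finsupp.single_apply, Ne.symm hWV] using he W
  have hz : ∀ e : Submodule ℝ E →₀ ℝ, V ∈ e.support → e ⊥ = 0 →
      (e - Finsupp.single V m) ⊥ = 0 := by
    intro e heV he0
    by_contra hne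
    exact Finsupp.mem_support_iff.1 (hsub e heV (Finsupp.mem_support_iff.2 hne)) he0
  have hlt : ∀ e : Submodule ℝ E →₀ ℝ, V ∈ e.support → e V = m →
      (e - Finsupp.single V m).support.card < e.support.card := by
    intro e heV hem
    refine Finset.card_lt_card ((hsub e heV).ssubset_of_mem_notMem heV ?_)
    simp [hem]
  have hcard : (c - Finsupp.single V m).support.card + (d - Finsupp.single V m).support.card
      < n := by
    have h1 := Finset.card_le_card (hsub c hcV)
    have h2 := Finset.card_le_card (hsub d hdV)
    rcases le_total (c V) (d V) with hle | hle
    · have := hlt c hcV (min_eq_left hle).symm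
      omega
    · have := hlt d hdV (min_eq_right hle).symm
      omega
  have := ih _ hcard (c - Finsupp.single V m) (d - Finsupp.single V m)
    (hnn c hc (min_le_left _ _)) (hnn d hd (min_le_right _ _))
    (hcc.mono (hsub c hcV)) (hdc.mono (hsub d hdV)) (hz c hcV hc0) (hz d hdV hd0)
    (by rw [map_sub, map_sub, h]) rfl
  exact sub_left_injective this

end Projections

/-! ### Singular values and the flag of an operator -/

section SingularValues

variable {E : Type v} {F : Type u} [NormedAddCommGroup E] [InnerProductSpace ℝ E]
  [FiniteDimensional ℝ E] [NormedAddCommGroup F] [InnerProductSpace ℝ F]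

/-- This is the eigenvalue of `∑ pᵢ P_{Vᵢ}` on the basis vector `e j` in the flag constructed below.
The substitution `i ↦ k - i` turns the sum into a telescoping one; for `j = k + 1` both sides are
zero. -/
theorem sum_telescope (σ : ℕ → ℝ) (j k : ℕ) (hj : j ≤ k + 1) :
    ∑ i : Fin (k + 1), (if j + (i : ℕ) ≤ k then σ (k - i) - σ (k - i + 1) else 0) =
      σ j - σ (k + 1) := by
  rw [Fin.sum_univ_eq_sum_range
    (fun i => if j + i ≤ k then σ (k - i) - σ (k - i + 1) else 0) (k + 1)]
  have h1 : ∀ m, j ≤ m → ∑ i ∈ Finset.range m, (if j ≤ i then σ i - σ (i + 1) else 0) =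
      σ j - σ m := by
    intro m hm
    induction m, hm using Nat.le_induction with
    | base =>
      rw [sub_self]
      exact Finset.sum_eq_zero fun i hi => if_neg (by rw [Finset.mem_range] at hi; omega)
    | succ m hm ih => rw [Finset.sum_range_succ, ih, if_pos hm]; ring
  rw [← h1 _ hj, ← Finset.sum_range_reflect]
  refine Finset.sum_congr rfl fun i hi => ?_
  rw [Finset.mem_range] at hi
  have h2 : k + 1 - 1 - i = k - i := by omega
  have h3 : k - (k - i) = i := by omega
  rw [h2, h3]
  exact if_congr (by omega) rfl rfl

theorem starProjection_span_basis {n : ℕ} (e : OrthonormalBasis (Fin n) ℝ E) (s : Set (Fin n))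
    [DecidablePred (· ∈ s)] (j : Fin n) :
    (Submodule.span ℝ (e '' s)).starProjection (e j) = if j ∈ s then e j else 0 := by
  split_ifs with h
  · exact Submodule.starProjection_eq_self_iff.2 (Submodule.subset_span ⟨j, h, rfl⟩)
  · rw [Submodule.starProjection_apply_eq_zero_iff, Submodule.mem_orthogonal]
    intro x hx
    induction hx using Submodule.span_induction with
    | mem x hx =>
      obtain ⟨i, hi, rfl⟩ := hx
      exact e.orthonormal.2 fun hij => h (hij ▸ hi)
    | zero => simp
    | add x y _ _ hx hy => rw [inner_add_left, hx, hy, add_zero]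
    | smul c x _ hx => rw [inner_smul_left, hx, mul_zero]

/-- The sorted singular values of an operator, with a corresponding orthonormal basis. -/
theorem exists_singular_basis [CompleteSpace F] (A : E →L[ℝ] F) :
    ∃ (σ : ℕ → ℝ) (e : OrthonormalBasis (Fin (Module.finrank ℝ E)) ℝ E), Antitone σ ∧
      (∀ i, 0 ≤ σ i) ∧ σ (Module.finrank ℝ E) = 0 ∧
      ∀ j, A.adjoint (A (e j)) = (σ j * σ j) • e j := by
  set T : E →L[ℝ] E := A.adjoint ∘L A
  have hT : T.toLinearMap.IsSymmetric := fun x y => by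
    change inner ℝ (A.adjoint (A x)) y = inner ℝ x (A.adjoint (A y))
    rw [ContinuousLinearMap.adjoint_inner_left, ContinuousLinearMap.adjoint_inner_right]
  set e := hT.eigenvectorBasis rfl
  set l := hT.eigenvalues rfl
  have hl : Antitone l := hT.eigenvalues_antitone rfl
  have he : ∀ j, A.adjoint (A (e j)) = l j • e j := hT.apply_eigenvectorBasis rfl
  have hl0 : ∀ j, 0 ≤ l j := by
    intro j
    have h1 : inner ℝ (A.adjoint (A (e j))) (e j) = ‖A (e j)‖ ^ 2 := by
      rw [ContinuousLinearMap.adjoint_inner_left, real_inner_self_eq_norm_sq]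
    rw [he, inner_smul_left, real_inner_self_eq_norm_sq, e.norm_eq_one] at h1
    have : l j = ‖A (e j)‖ ^ 2 := by simpa using h1
    rw [this]; positivity
  -- Extending by zero past the dimension provides a vanishing value even when `A` is injective, so
  -- the last difference needs no separate case.
  refine ⟨fun i => if h : i < Module.finrank ℝ E then √(l ⟨i, h⟩) else 0, e, ?_, ?_, ?_, ?_⟩
  · intro i j hij
    dsimp only
    split_ifs with h1 h2 h2
    · exact Real.sqrt_le_sqrt (hl hij)
    · omega
    · exact Real.sqrt_nonneg _
    · exact le_rfl
  · intro i
    dsimp only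
    split_ifs
    · exact Real.sqrt_nonneg _
    · exact le_rfl
  · simp
  · intro j
    simp [he, Real.mul_self_sqrt (hl0 j)]

/-- A nonzero operator `A` factors as a weighted sum of the orthogonal projections to a flag of
nonzero subspaces, followed by an operator that is isometric on the largest one. -/
theorem exists_flag_decomposition [CompleteSpace F] (A : E →L[ℝ] F) (hA : A ≠ 0) :
    ∃ (k : ℕ) (V : Fin (k + 1) → Submodule ℝ E) (p : Fin (k + 1) → ℝ) (B : E →L[ℝ] F),
      Antitone V ∧ (∀ i, V i ≠ ⊥) ∧ (∀ i, 0 ≤ p i) ∧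
      (∀ x, A x = B (∑ i, p i • (V i).starProjection x)) ∧
      (∀ y ∈ V 0, ‖B y‖ = ‖y‖) ∧ ∀ y ∈ V 0, ∃ z, B y = A z := by
  classical
  obtain ⟨σ, e, hσ, hσ0, hσn, hAe⟩ := exists_singular_basis A
  have hnorm : ∀ j, ‖A (e j)‖ ^ 2 = σ j * σ j := by
    intro j
    rw [← real_inner_self_eq_norm_sq, ← ContinuousLinearMap.adjoint_inner_left, hAe,
      inner_smul_left, real_inner_self_eq_norm_sq, e.norm_eq_one]
    simp
  have hzero : ∀ j : Fin _, σ j = 0 → A (e j) = 0 := by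
    intro j hj
    have := hnorm j
    rw [hj] at this
    simpa using this
  have hs0 : σ 0 ≠ 0 := by
    intro h0
    apply hA
    apply ContinuousLinearMap.coe_injective
    refine e.toBasis.ext fun j => ?_
    rw [OrthonormalBasis.coe_toBasis]
    exact hzero j (le_antisymm (h0 ▸ hσ (Nat.zero_le _)) (hσ0 _))
  have hex : ∃ r, σ r = 0 := ⟨_, hσn⟩
  -- The first index with vanishing singular value is the rank of `A`, which is positive as `A ≠ 0`.
  obtain ⟨k, hk⟩ : ∃ k, Nat.find hex = k + 1 :=
    Nat.exists_eq_succ_of_ne_zero fun h => hs0 (h ▸ Nat.find_spec hex)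
  have hk1 : σ (k + 1) = 0 := hk ▸ Nat.find_spec hex
  have hpos : ∀ j ≤ k, σ j ≠ 0 := fun j hj => Nat.find_min hex (by omega)
  have hkn : k < Module.finrank ℝ E := by
    have := Nat.find_min' hex hσn
    omega
  -- `V i` is spanned by the first `k + 1 - i` basis vectors. A repeated singular value merely
  -- produces a zero weight.
  set s : Fin (k + 1) → Set (Fin (Module.finrank ℝ E)) := fun i => {j | (j : ℕ) + i ≤ k}
  set V : Fin (k + 1) → Submodule ℝ E := fun i => Submodule.span ℝ (e '' s i)
  set p : Fin (k + 1) → ℝ := fun i => σ (k - i) - σ (k - i + 1)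
  -- The partial isometry of the polar decomposition `A = B S`; the convention `0⁻¹ = 0` makes it
  -- vanish on the kernel of `A`.
  set B : E →L[ℝ] F := ∑ j, (innerSL ℝ (e j)).smulRight ((σ j)⁻¹ • A (e j))
  set S : E →L[ℝ] E := ∑ i, p i • (V i).starProjection
  have hS : ∀ x, S x = ∑ i, p i • (V i).starProjection x := fun x => by simp [S]
  have hSe : ∀ j, S (e j) = σ j • e j := by
    intro j
    have h1 : S (e j) = ∑ i : Fin (k + 1),
        (if (j : ℕ) + i ≤ k then σ (k - i) - σ (k - i + 1) else 0) • e j := by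
      rw [hS]
      refine Finset.sum_congr rfl fun i _ => ?_
      rw [starProjection_span_basis]
      by_cases h : (j : ℕ) + i ≤ k
      · rw [if_pos h, if_pos (show j ∈ s i from h)]
      · rw [if_neg h, if_neg (show j ∉ s i from h), zero_smul, smul_zero]
    rw [h1, ← Finset.sum_smul]
    rcases le_or_gt (j : ℕ) (k + 1) with hj | hj
    · rw [sum_telescope σ j k hj, hk1, sub_zero]
    · have : σ j = 0 := le_antisymm (hk1 ▸ hσ hj.le) (hσ0 _)
      rw [this, Finset.sum_eq_zero fun i _ => if_neg (by omega)]
  have hBe : ∀ j, B (e j) = (σ j)⁻¹ • A (e j) := by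
    intro j
    simp only [B, sum_apply, ContinuousLinearMap.smulRight_apply, innerSL_apply_apply]
    rw [Finset.sum_eq_single j]
    · rw [real_inner_self_eq_norm_sq, e.norm_eq_one]; simp
    · intro i _ hij
      rw [e.orthonormal.2 hij, zero_smul]
    · simp
  have hAB : ∀ x, A x = B (S x) := by
    intro x
    have : A.toLinearMap = (B ∘L S).toLinearMap := by
      refine e.toBasis.ext fun j => ?_
      rw [OrthonormalBasis.coe_toBasis]
      change A (e j) = B (S (e j))
      rw [hSe, map_smul, hBe, smul_smul]
      by_cases h : σ j = 0
      · rw [hzero j h, smul_zero]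
      · rw [mul_inv_cancel₀ h, one_smul]
    exact LinearMap.congr_fun this x
  have hSS : ∀ x, S (S x) = A.adjoint (A x) := by
    intro x
    have : (S ∘L S).toLinearMap = (A.adjoint ∘L A).toLinearMap := by
      refine e.toBasis.ext fun j => ?_
      rw [OrthonormalBasis.coe_toBasis]
      change S (S (e j)) = A.adjoint (A (e j))
      rw [hSe, map_smul, hSe, hAe, smul_smul]
    exact LinearMap.congr_fun this x
  have hSsymm : ∀ x y, inner ℝ (S x) y = inner ℝ x (S y) := by
    intro x y
    rw [hS, hS, sum_inner, inner_sum]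
    refine Finset.sum_congr rfl fun i _ => ?_
    rw [inner_smul_left, inner_smul_right, Submodule.inner_starProjection_left_eq_right]
    simp
  have hV0 : ∀ y ∈ V 0, ∃ z, S z = y := by
    intro y hy
    change y ∈ LinearMap.range S.toLinearMap
    refine (Submodule.span_le.2 ?_ : V 0 ≤ _) hy
    rintro _ ⟨j, hj, rfl⟩
    refine ⟨(σ j)⁻¹ • e j, ?_⟩
    change S _ = _
    rw [map_smul, hSe, smul_smul, inv_mul_cancel₀ (hpos j (by simpa [s] using hj)), one_smul]
  refine ⟨k, V, p, B, ?_, ?_, ?_, ?_, ?_, ?_⟩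
  · intro i i' hii
    refine Submodule.span_mono (Set.image_mono fun j hj => ?_)
    have : (i : ℕ) ≤ i' := hii
    change (j : ℕ) + i ≤ k
    change (j : ℕ) + i' ≤ k at hj
    omega
  · intro i hi
    have h1 : e ⟨0, by omega⟩ ∈ V i := Submodule.subset_span ⟨_, by
      change 0 + (i : ℕ) ≤ k
      omega, rfl⟩
    rw [hi, Submodule.mem_bot] at h1
    have := e.norm_eq_one ⟨0, by omega⟩
    rw [h1, norm_zero] at this
    exact zero_ne_one this
  · exact fun i => sub_nonneg.2 (hσ (Nat.le_succ _))
  · intro x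
    rw [hAB, hS]
  · intro y hy
    obtain ⟨z, rfl⟩ := hV0 y hy
    -- On `range S`: `‖B S z‖² = ‖A z‖² = ⟪A* A z, z⟫ = ⟪S² z, z⟫ = ‖S z‖²`.
    rw [← hAB, ← sq_eq_sq₀ (norm_nonneg _) (norm_nonneg _), ← real_inner_self_eq_norm_sq,
      ← real_inner_self_eq_norm_sq, hSsymm, hSS, ContinuousLinearMap.adjoint_inner_right]
  · intro y hy
    obtain ⟨z, rfl⟩ := hV0 y hy
    exact ⟨z, (hAB z).symm⟩

end SingularValues

/-- Change of variables for pushed forward barycentric coordinates: this is why weighted sums over a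
chain respect the gluing relation. -/
theorem sum_stdSimplex_map_smul {M : Type*} [AddCommMonoid M] [Module ℝ M] {m k : ℕ}
    (θ : Fin (m + 1) → Fin (k + 1)) (p : stdSimplex ℝ (Fin (m + 1))) (f : Fin (k + 1) → M) :
    ∑ i, stdSimplex.map θ p i • f i = ∑ j, p j • f (θ j) := by
  classical
  rw [stdSimplex.map_coe]
  simp only [FunOnFinite.linearMap_apply_apply, Finset.sum_smul, Finset.sum_filter]
  simp only [ite_smul, zero_smul]
  rw [Finset.sum_comm]
  simp

/-! ### The operator attached to a point of the homotopy colimit -/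

namespace BarSimplex

variable {α : OrthRep.{v} Γ} {U U' U₁ U₂ U₁' U₂' : OrthRep.{u} Γ} {k m : ℕ}

/-- The weighted sum of the orthogonal projections to the subspaces in the chain. -/
def flagOp (σ : BarSimplex α U U' k) (p : stdSimplex ℝ (Fin (k + 1))) : α →L[ℝ] α :=
  ∑ i, p i • (σ.chain i).1.starProjection

theorem flagOp_apply (σ : BarSimplex α U U' k) (p : stdSimplex ℝ (Fin (k + 1))) (y : α) :
    σ.flagOp p y = ∑ i, p i • (σ.chain i).1.starProjection y := by
  simp [flagOp]

theorem flagOp_mem (σ : BarSimplex α U U' k) (p : stdSimplex ℝ (Fin (k + 1))) (y : α) :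
    σ.flagOp p y ∈ (σ.chain 0).1 := by
  rw [flagOp_apply]
  exact Submodule.sum_mem _ fun i _ => Submodule.smul_mem _ _
    (σ.anti (Fin.zero_le i) (Submodule.starProjection_apply_mem _ _))

theorem flagOp_reindex (θ : Fin (m + 1) →o Fin (k + 1)) (σ : BarSimplex α U U' k)
    (p : stdSimplex ℝ (Fin (m + 1))) :
    (σ.reindex θ).flagOp p = σ.flagOp (stdSimplex.map θ p) := by
  ext y
  rw [flagOp_apply, flagOp_apply,
    sum_stdSimplex_map_smul θ p fun i => (σ.chain i).1.starProjection y]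
  rfl

theorem flagOp_mapAux (a : α ≃ₗᵢ[ℝ] α) (i : Mor U₂ U₁) (j : Mor U₁' U₂')
    (σ : BarSimplex α U₁ U₁' k) (p : stdSimplex ℝ (Fin (k + 1))) (y : α) :
    (σ.mapAux a i j).flagOp p y = a (σ.flagOp p (a.symm y)) := by
  rw [flagOp_apply, flagOp_apply, _root_.map_sum]
  refine Finset.sum_congr rfl fun r _ => ?_
  rw [_root_.map_smul]
  exact congrArg (p r • ·) (Submodule.starProjection_map_apply a (σ.chain r).1 y)

theorem norm_flagOp_apply_le (σ : BarSimplex α U U' k) (p : stdSimplex ℝ (Fin (k + 1))) (y : α) :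
    ‖σ.flagOp p y‖ ≤ ‖y‖ := by
  rw [flagOp_apply]
  calc ‖∑ i, p i • (σ.chain i).1.starProjection y‖ ≤ ∑ i, p i * ‖y‖ := by
        refine norm_sum_le_of_le _ fun i _ => ?_
        rw [norm_smul, Real.norm_of_nonneg (stdSimplex.zero_le p i)]
        exact mul_le_mul_of_nonneg_left (Submodule.norm_starProjection_apply_le _ _)
          (stdSimplex.zero_le p i)
    _ = ‖y‖ := by rw [← Finset.sum_mul, stdSimplex.sum_eq_one, one_mul]

theorem flagOp_apply_of_mem_last (σ : BarSimplex α U U' k) (p : stdSimplex ℝ (Fin (k + 1)))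
    {y : α} (hy : y ∈ (σ.chain (Fin.last k)).1) : σ.flagOp p y = y := by
  rw [flagOp_apply]
  have : ∀ i, (σ.chain i).1.starProjection y = y := fun i =>
    Submodule.starProjection_eq_self_iff.2 (σ.anti (Fin.le_last i) hy)
  simp only [this]
  rw [← Finset.sum_smul, stdSimplex.sum_eq_one, one_smul]

/-- The operator `y ↦ g (0, P_{V₀} y)`. -/
def right (σ : BarSimplex α U U' k) : α →L[ℝ] U' :=
  extend (σ.chain 0).1 σ.emb ∘L
    ((WithLp.prodContinuousLinearEquiv 2 ℝ U α).symm.toContinuousLinearMap ∘L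
      ContinuousLinearMap.inr ℝ U α)

/-- The restriction of the embedding `U ⊕ V₀ → U'` to `U`. -/
def left (σ : BarSimplex α U U' k) : U →L[ℝ] U' :=
  extend (σ.chain 0).1 σ.emb ∘L
    ((WithLp.prodContinuousLinearEquiv 2 ℝ U α).symm.toContinuousLinearMap ∘L
      ContinuousLinearMap.inl ℝ U α)

theorem orthogonalProjectionOnto_eq {V : Submodule ℝ α} {y : α} (hy : y ∈ V) :
    V.orthogonalProjectionOnto y = ⟨y, hy⟩ :=
  Subtype.ext (Submodule.starProjection_eq_self_iff.2 hy)

theorem right_apply (σ : BarSimplex α U U' k) {y : α} (hy : y ∈ (σ.chain 0).1) :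
    σ.right y = σ.emb (WithLp.toLp 2 (0, ⟨y, hy⟩)) := by
  rw [← orthogonalProjectionOnto_eq hy]
  rfl

theorem left_apply (σ : BarSimplex α U U' k) (x : U) :
    σ.left x = σ.emb (WithLp.toLp 2 (x, 0)) := by
  change σ.emb (WithLp.toLp 2 (x, (σ.chain 0).1.orthogonalProjectionOnto 0)) = _
  rw [_root_.map_zero]

theorem emb_apply (σ : BarSimplex α U U' k) (x : U) {y : α} (hy : y ∈ (σ.chain 0).1) :
    σ.emb (WithLp.toLp 2 (x, ⟨y, hy⟩)) = σ.left x + σ.right y := by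
  rw [left_apply, right_apply σ hy, ← _root_.map_add, ← WithLp.toLp_add, Prod.mk_add_mk, add_zero,
    zero_add]

theorem norm_right_apply (σ : BarSimplex α U U' k) {y : α} (hy : y ∈ (σ.chain 0).1) :
    ‖σ.right y‖ = ‖y‖ := by
  rw [right_apply σ hy, LinearIsometry.norm_map]
  simp

theorem inner_left_right (σ : BarSimplex α U U' k) (x : U) {y : α} (hy : y ∈ (σ.chain 0).1) :
    inner ℝ (σ.left x) (σ.right y) = 0 := by
  rw [left_apply, right_apply σ hy, LinearIsometry.inner_map_map]
  simp [WithLp.prod_inner_apply]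

/-- The operator `α → U'` attached to a point of a simplex of the bar construction. -/
def op (σ : BarSimplex α U U' k) (p : stdSimplex ℝ (Fin (k + 1))) : α →L[ℝ] U' :=
  σ.right ∘L σ.flagOp p

theorem op_apply (σ : BarSimplex α U U' k) (p : stdSimplex ℝ (Fin (k + 1))) (y : α) :
    σ.op p y = σ.right (σ.flagOp p y) := rfl

/-- The two weighted sums of projections agree, and their values lie in `V_{θ 0}`, where the
restricted embedding coincides with the original one. -/
theorem op_reindex (θ : Fin (m + 1) →o Fin (k + 1)) (σ : BarSimplex α U U' k)
    (p : stdSimplex ℝ (Fin (m + 1))) :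
    (σ.reindex θ).op p = σ.op (stdSimplex.map θ p) := by
  ext y
  rw [op_apply, op_apply, ← flagOp_reindex,
    right_apply _ (flagOp_mem (σ.reindex θ) p y),
    right_apply _ (σ.anti (Fin.zero_le (θ 0)) (flagOp_mem (σ.reindex θ) p y))]
  rfl

/-- The projection to `a V` is `a P_V a⁻¹`, and its leading `a` cancels against the `a⁻¹` in the new
embedding. -/
theorem op_mapAux (a : α ≃ₗᵢ[ℝ] α) (i : Mor U₂ U₁) (j : Mor U₁' U₂')
    (σ : BarSimplex α U₁ U₁' k) (p : stdSimplex ℝ (Fin (k + 1))) (y : α) :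
    (σ.mapAux a i j).op p y = j (σ.op p (a.symm y)) := by
  rw [op_apply, op_apply, right_apply _ (flagOp_mem _ _ _), right_apply _ (flagOp_mem _ _ _)]
  change j (σ.emb (WithLp.toLp 2 (i 0, NZSub.back a (σ.chain 0) _))) = _
  congr 4
  · exact _root_.map_zero i
  · refine Subtype.ext ((NZSub.coe_back _ _ _).trans ?_)
    change a.symm ((σ.mapAux a i j).flagOp p y) = _
    rw [flagOp_mapAux, LinearIsometryEquiv.symm_apply_apply]

theorem norm_op_apply (σ : BarSimplex α U U' k) (p : stdSimplex ℝ (Fin (k + 1))) (y : α) :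
    ‖σ.op p y‖ = ‖σ.flagOp p y‖ :=
  norm_right_apply σ (flagOp_mem σ p y)

/-- A convex combination of projections is a contraction, and it fixes the smallest subspace `V_k ≠
0` of the chain pointwise. The embedding preserves norms on `V₀`. -/
theorem norm_op (σ : BarSimplex α U U' k) (p : stdSimplex ℝ (Fin (k + 1))) : ‖σ.op p‖ = 1 := by
  refine le_antisymm (ContinuousLinearMap.opNorm_le_bound _ zero_le_one fun y => ?_) ?_
  · rw [one_mul, norm_op_apply]
    exact norm_flagOp_apply_le σ p y
  · obtain ⟨y, hy, hy0⟩ := Submodule.exists_mem_ne_zero_of_ne_bot (σ.chain (Fin.last k)).2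
    have h := (σ.op p).le_opNorm y
    rw [norm_op_apply, flagOp_apply_of_mem_last σ p hy] at h
    have : 0 < ‖y‖ := norm_pos_iff.2 hy0
    nlinarith

/-- The projections and the extended embedding through which simplices are topologized. -/
def code (σ : BarSimplex α U U' k) :
    (Fin (k + 1) → (α →L[ℝ] α)) × (WithLp 2 (U × α) →L[ℝ] U') :=
  (fun i => (σ.chain i).1.starProjection, extend (σ.chain 0).1 σ.emb)

theorem continuous_code : Continuous (code : BarSimplex α U U' k → _) :=
  continuous_induced_dom

theorem continuous_extend :
    Continuous fun σ : BarSimplex α U U' k => extend (σ.chain 0).1 σ.emb :=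
  continuous_snd.comp continuous_code

theorem continuous_starProjection (i : Fin (k + 1)) :
    Continuous fun σ : BarSimplex α U U' k => (σ.chain i).1.starProjection :=
  (continuous_apply i).comp (continuous_fst.comp continuous_code)

theorem continuous_left : Continuous (left : BarSimplex α U U' k → U →L[ℝ] U') :=
  continuous_extend.clm_comp continuous_const

theorem continuous_right : Continuous (right : BarSimplex α U U' k → α →L[ℝ] U') :=
  continuous_extend.clm_comp continuous_const

theorem continuous_op : Continuous fun x : BarSimplex α U U' k × stdSimplex ℝ (Fin (k + 1)) =>
    x.1.op x.2 := by
  refine (continuous_right.comp continuous_fst).clm_comp (continuous_finsetSum _ fun i _ => ?_)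
  exact ((continuous_apply i).comp (continuous_subtype_val.comp continuous_snd)).smul
    ((continuous_starProjection i).comp continuous_fst)

end BarSimplex

namespace Hocolim

variable {α : OrthRep.{v} Γ} {U U' U₁ U₂ U₁' U₂' : OrthRep.{u} Γ}

/-- The operator `α → U'` attached to a point of the homotopy colimit. -/
def op : Hocolim α U U' → (α →L[ℝ] U') :=
  Quot.lift (fun x => x.2.1.op x.2.2) (by
    rintro _ _ ⟨θ, σ, p⟩
    exact BarSimplex.op_reindex θ σ p)

theorem op_mapAux (a : α ≃ₗᵢ[ℝ] α) (i : Mor U₂ U₁) (j : Mor U₁' U₂') (x : Hocolim α U₁ U₁')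
    (y : α) : (mapAux a i j x).op y = j (x.op (a.symm y)) := by
  obtain ⟨k, σ, p⟩ := x
  exact σ.op_mapAux a i j p y

theorem norm_op (x : Hocolim α U U') : ‖x.op‖ = 1 := by
  obtain ⟨k, σ, p⟩ := x
  exact σ.norm_op p

theorem toMor_mk {k : ℕ} (σ : BarSimplex α U U' k) (p : stdSimplex ℝ (Fin (k + 1))) :
    (toMor (Quot.mk _ ⟨k, σ, p⟩)).toContinuousLinearMap = σ.left := by
  ext x
  exact (σ.left_apply x).symm

/-- The summands of `U ⊕ V₀` are orthogonal, and `g` preserves inner products. -/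
theorem op_apply_mem (x : Hocolim α U U') (y : α) :
    x.op y ∈ (LinearMap.range x.toMor.toLinearMap)ᗮ := by
  obtain ⟨k, σ, p⟩ := x
  rw [Submodule.mem_orthogonal]
  rintro _ ⟨z, rfl⟩
  have h := σ.inner_left_right z (σ.flagOp_mem p y)
  rw [← toMor_mk σ p] at h
  exact h

theorem continuous_op : Continuous (op : Hocolim α U U' → α →L[ℝ] U') :=
  continuous_quot_lift _ (continuous_sigma fun _ => BarSimplex.continuous_op)

theorem continuous_toMor : Continuous (toMor : Hocolim α U U' → Mor U U') := by
  refine continuous_quot_lift _ (continuous_sigma fun k => continuous_induced_rng.2 ?_)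
  exact (BarSimplex.continuous_left.comp continuous_fst).congr fun x => (toMor_mk x.1 x.2).symm

/-- The tensor in `α ⊗ U'` attached to a point of the homotopy colimit. -/
def tensor (x : Hocolim α U U') : α ⊗[ℝ] U' := (tensorHom α U').symm x.op

theorem tensorHom_tensor (x : Hocolim α U U') : tensorHom α U' x.tensor = x.op :=
  (tensorHom α U').apply_symm_apply _

theorem tensor_ne_zero (x : Hocolim α U U') : x.tensor ≠ 0 := by
  intro h
  have h1 := norm_op x
  rw [← tensorHom_tensor, h, _root_.map_zero, norm_zero] at h1
  exact zero_ne_one h1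

theorem continuous_tensor : Continuous (tensor : Hocolim α U U' → α ⊗[ℝ] U') :=
  (LinearMap.continuous_of_finiteDimensional (tensorHom α U').symm.toLinearMap).comp continuous_op

theorem tensor_mapAux (a : α ≃ₗᵢ[ℝ] α) (i : Mor U₂ U₁) (j : Mor U₁' U₂') (x : Hocolim α U₁ U₁') :
    (mapAux a i j x).tensor =
      TensorProduct.map a.toLinearEquiv.toLinearMap j.toLinearMap x.tensor := by
  apply (tensorHom α U₂').injective
  ext y
  rw [tensorHom_tensor, op_mapAux, tensorHom_map, tensorHom_tensor]
  rfl

/-- The point of the sphere bundle attached to a point of the homotopy colimit. -/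
def toSphere (x : Hocolim α U U') : SphereBundle α U U' :=
  -- The norm on tensors is the Hilbert–Schmidt norm, which need not be one when the operator norm
  -- is; hence the rescaling.
  ⟨⟨(x.toMor, ‖x.tensor‖⁻¹ • x.tensor), (mem_range_lTensor_iff _ _).2 fun y => by
    rw [_root_.map_smul, tensorHom_tensor]
    exact Submodule.smul_mem _ _ (op_apply_mem x y)⟩, by
    change ‖‖x.tensor‖⁻¹ • x.tensor‖ = 1
    rw [norm_smul, norm_inv, norm_norm, inv_mul_cancel₀ (norm_ne_zero_iff.2 (tensor_ne_zero x))]⟩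

theorem toSphere_vec (x : Hocolim α U U') : x.toSphere.1.vec = ‖x.tensor‖⁻¹ • x.tensor := rfl

theorem continuous_toSphere : Continuous (toSphere : Hocolim α U U' → SphereBundle α U U') :=
  Continuous.subtype_mk (Continuous.subtype_mk (continuous_toMor.prodMk
    ((continuous_tensor.norm.inv₀ fun x => norm_ne_zero_iff.2 (tensor_ne_zero x)).smul
      continuous_tensor)) _) _

/-- The map `a ⊗ j` preserves the tensor norm, so it commutes with the rescaling. -/
theorem toSphere_mapAux (a : α ≃ₗᵢ[ℝ] α) (i : Mor U₂ U₁) (j : Mor U₁' U₂')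
    (x : Hocolim α U₁ U₁') :
    (mapAux a i j x).toSphere.1 = Bundle.mapAux a i j x.toSphere.1 := by
  refine Bundle.ext (toMor_mapAux a i j x) ?_
  change _ = TensorProduct.map _ _ (‖x.tensor‖⁻¹ • x.tensor)
  rw [toSphere_vec, tensor_mapAux, _root_.map_smul]
  congr 2
  exact TensorProduct.norm_map a.toLinearIsometry j x.tensor

end Hocolim

/-! ### Recovering a point of the homotopy colimit from its operator -/

/-- The range of a symmetric operator is the complement of its kernel, and the kernel is contained
in `Vᗮ`. -/
theorem le_range_weightOp {E : Type v} [NormedAddCommGroup E] [InnerProductSpace ℝ E]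
    [FiniteDimensional ℝ E] {c : Submodule ℝ E →₀ ℝ} (hc : ∀ V, 0 ≤ c V) {V : Submodule ℝ E}
    (hV : V ∈ c.support) : V ≤ LinearMap.range (weightOp E c).toLinearMap := by
  rw [← Submodule.orthogonal_orthogonal (LinearMap.range _),
    (weightOp_isSymmetric c).orthogonal_range, ← Submodule.orthogonal_orthogonal V]
  exact Submodule.orthogonal_le fun x hx => (weightOp_apply_eq_zero_iff hc x).1 hx V hV

/-- A finite nonempty chain in a partial order can be listed in decreasing order. -/
theorem exists_strictAnti_of_isChain {P : Type*} [PartialOrder P] (s : Finset P)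
    (hs : IsChain (· ≤ ·) (s : Set P)) (hne : s.Nonempty) :
    ∃ (m : ℕ) (W : Fin (m + 1) → P), StrictAnti W ∧ ∀ x, x ∈ s ↔ ∃ i, W i = x := by
  classical
  let _ : LinearOrder s :=
    { (inferInstance : PartialOrder s) with
      le_total := fun a b => hs.total a.2 b.2
      toDecidableLE := Classical.decRel _ }
  obtain ⟨m, hm⟩ : ∃ m, s.card = m + 1 := Nat.exists_eq_succ_of_ne_zero hne.card_pos.ne'
  let e : Fin (m + 1) ≃o s := monoEquivOfFin s (by rw [Fintype.card_coe, hm])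
  refine ⟨m, fun i => (e i.rev).1, fun i j hij => ?_, fun x => ⟨fun hx => ?_, ?_⟩⟩
  · have : e j.rev < e i.rev := e.lt_iff_lt.2 (Fin.rev_lt_rev.2 hij)
    exact this
  · exact ⟨(e.symm ⟨x, hx⟩).rev, by simp⟩
  · rintro ⟨i, rfl⟩
    exact (e i.rev).2

namespace BarSimplex

variable {α : OrthRep.{v} Γ} {U U' : OrthRep.{u} Γ} {k m : ℕ}

/-- The weight on subspaces given by the barycentric coordinates on the chain. -/
def weight (σ : BarSimplex α U U' k) (p : stdSimplex ℝ (Fin (k + 1))) : Submodule ℝ α →₀ ℝ :=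
  ∑ i, Finsupp.single (σ.chain i).1 (p i)

theorem weightOp_weight (σ : BarSimplex α U U' k) (p : stdSimplex ℝ (Fin (k + 1))) :
    weightOp α (σ.weight p) = σ.flagOp p := by
  simp [weight, weightOp, flagOp, Finsupp.linearCombination_single]

theorem weight_apply [DecidableEq (Submodule ℝ α)] (σ : BarSimplex α U U' k)
    (p : stdSimplex ℝ (Fin (k + 1))) (V : Submodule ℝ α) :
    σ.weight p V = ∑ i, if (σ.chain i).1 = V then p i else 0 := by
  simp [weight, Finsupp.finsetSum_apply, Finsupp.single_apply]

theorem weight_nonneg (σ : BarSimplex α U U' k) (p : stdSimplex ℝ (Fin (k + 1)))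
    (V : Submodule ℝ α) : 0 ≤ σ.weight p V := by
  classical
  rw [weight_apply]
  refine Finset.sum_nonneg fun i _ => ?_
  split_ifs
  · exact stdSimplex.zero_le p i
  · exact le_rfl

/-- Coordinates of a repeated subspace add up, and being nonnegative they cannot cancel. -/
theorem mem_support_weight (σ : BarSimplex α U U' k) (p : stdSimplex ℝ (Fin (k + 1)))
    (V : Submodule ℝ α) :
    V ∈ (σ.weight p).support ↔ ∃ i, p i ≠ 0 ∧ (σ.chain i).1 = V := by
  classical
  rw [Finsupp.mem_support_iff, weight_apply, Ne, Finset.sum_eq_zero_iff_of_nonneg]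
  · push Not
    simp [and_comm]
  · intro i _
    split_ifs
    · exact stdSimplex.zero_le p i
    · exact le_rfl

theorem isChain_support_weight (σ : BarSimplex α U U' k) (p : stdSimplex ℝ (Fin (k + 1))) :
    IsChain (· ≤ ·) ((σ.weight p).support : Set (Submodule ℝ α)) := by
  intro V hV W hW _
  obtain ⟨i, -, rfl⟩ := (σ.mem_support_weight p V).1 hV
  obtain ⟨j, -, rfl⟩ := (σ.mem_support_weight p W).1 hW
  rcases le_total i j with h | h
  · exact Or.inr (σ.anti h)
  · exact Or.inl (σ.anti h)

theorem weight_bot (σ : BarSimplex α U U' k) (p : stdSimplex ℝ (Fin (k + 1))) :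
    σ.weight p ⊥ = 0 := by
  by_contra h
  obtain ⟨i, -, hi⟩ := (σ.mem_support_weight p ⊥).1 (Finsupp.mem_support_iff.2 h)
  exact (σ.chain i).2 hi

theorem exists_pos (p : stdSimplex ℝ (Fin (k + 1))) : ∃ i, p i ≠ 0 := by
  by_contra! h
  have := stdSimplex.sum_eq_one p
  simp [h] at this

theorem flagOp_isSymmetric (σ : BarSimplex α U U' k) (p : stdSimplex ℝ (Fin (k + 1))) :
    (σ.flagOp p).toLinearMap.IsSymmetric := by
  rw [← weightOp_weight]
  exact weightOp_isSymmetric _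

theorem inner_flagOp_self_nonneg (σ : BarSimplex α U U' k) (p : stdSimplex ℝ (Fin (k + 1)))
    (y : α) : 0 ≤ inner ℝ (σ.flagOp p y) y := by
  rw [← weightOp_weight, inner_weightOp_self]
  exact Finset.sum_nonneg fun V _ => mul_nonneg (σ.weight_nonneg p V) (sq_nonneg _)

/-- In operator form this is `A* A = S²`; it holds because `g` is isometric on `V₀` and `S` is
symmetric. -/
theorem inner_op_op (σ : BarSimplex α U U' k) (p : stdSimplex ℝ (Fin (k + 1))) (y z : α) :
    inner ℝ (σ.op p y) (σ.op p z) = inner ℝ (σ.flagOp p (σ.flagOp p y)) z := by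
  rw [op_apply, op_apply, right_apply _ (flagOp_mem _ _ _), right_apply _ (flagOp_mem _ _ _),
    LinearIsometry.inner_map_map]
  simp only [WithLp.prod_inner_apply, inner_zero_left, zero_add]
  exact (σ.flagOp_isSymmetric p (σ.flagOp p y) z).symm

/-- The operator attached to a point of a simplex determines the weighted sum of projections. -/
theorem flagOp_eq_of_op_eq (σ : BarSimplex α U U' k) (p : stdSimplex ℝ (Fin (k + 1)))
    (τ : BarSimplex α U U' m) (q : stdSimplex ℝ (Fin (m + 1))) (h : σ.op p = τ.op q) :
    σ.flagOp p = τ.flagOp q := by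
  refine eq_of_sq_eq (σ.flagOp_isSymmetric p) (τ.flagOp_isSymmetric q)
    (τ.inner_flagOp_self_nonneg q) (σ.inner_flagOp_self_nonneg p) fun x => ?_
  refine ext_inner_right ℝ fun y => ?_
  rw [← inner_op_op, ← inner_op_op, h]

/-- The operator attached to a point of a simplex determines the weight. -/
theorem weight_eq_of_op_eq (σ : BarSimplex α U U' k) (p : stdSimplex ℝ (Fin (k + 1)))
    (τ : BarSimplex α U U' m) (q : stdSimplex ℝ (Fin (m + 1))) (h : σ.op p = τ.op q) :
    σ.weight p = τ.weight q := by
  refine weightOp_injOn _ _ (σ.weight_nonneg p) (τ.weight_nonneg q) (σ.isChain_support_weight p)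
    (τ.isChain_support_weight q) (σ.weight_bot p) (τ.weight_bot q) ?_
  rw [weightOp_weight, weightOp_weight, flagOp_eq_of_op_eq σ p τ q h]

theorem exists_chain (σ : BarSimplex α U U' k) (p : stdSimplex ℝ (Fin (k + 1))) :
    ∃ (m : ℕ) (W : Fin (m + 1) → NZSub α), StrictAnti W ∧
      ∀ V, V ∈ (σ.weight p).support ↔ ∃ i, (W i).1 = V := by
  obtain ⟨i₀, hi₀⟩ := exists_pos p
  obtain ⟨m, W, hW, hs⟩ := exists_strictAnti_of_isChain _ (σ.isChain_support_weight p)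
    ⟨_, (σ.mem_support_weight p _).2 ⟨i₀, hi₀, rfl⟩⟩
  refine ⟨m, fun i => ⟨W i, fun h => ?_⟩, fun i j hij => hW hij, hs⟩
  have := (hs ⊥).2 ⟨i, h⟩
  exact Finsupp.mem_support_iff.1 this (σ.weight_bot p)

/-- Every point of the homotopy colimit is represented by a simplex on any decreasing listing of the
support of its weight. -/
theorem exists_mk_eq (σ : BarSimplex α U U' k) (p : stdSimplex ℝ (Fin (k + 1)))
    (W : Fin (m + 1) → NZSub α) (hW : StrictAnti W)
    (hs : ∀ V, V ∈ (σ.weight p).support ↔ ∃ i, (W i).1 = V) :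
    ∃ (τ : BarSimplex α U U' m) (q : stdSimplex ℝ (Fin (m + 1))), τ.chain = W ∧
      Quot.mk (RealizationRel α U U') ⟨k, σ, p⟩ = Quot.mk _ ⟨m, τ, q⟩ := by
  classical
  -- Passing to the face `ι` discards the vertices with coordinate zero; the map `Θ` then collapses
  -- repeated subspaces.
  set I : Finset (Fin (k + 1)) := Finset.univ.filter fun i => p i ≠ 0
  obtain ⟨i₀, hi₀⟩ := exists_pos p
  obtain ⟨l, hl⟩ : ∃ l, I.card = l + 1 := Nat.exists_eq_succ_of_ne_zero
    (Finset.card_pos.2 ⟨i₀, by simp [I, hi₀]⟩).ne'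
  set ι : Fin (l + 1) ↪o Fin (k + 1) := I.orderEmbOfFin hl
  have hι : ∀ j, p (ι j) ≠ 0 := fun j =>
     (Finset.mem_filter.1 (I.orderEmbOfFin_mem hl j)).2
  have hmap : ∀ f : Fin (k + 1) → ℝ, ∑ j, f (ι j) = ∑ i ∈ I, f i := fun f => by
    rw [← I.image_orderEmbOfFin_univ hl, Finset.sum_image fun _ _ _ _ h => ι.injective h]
  let q' : stdSimplex ℝ (Fin (l + 1)) := ⟨fun j => p (ι j), fun j => stdSimplex.zero_le p _, by
    change ∑ j, p (ι j) = 1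
    rw [hmap p, ← stdSimplex.sum_eq_one p]
    exact Finset.sum_filter_ne_zero _⟩
  have hq' : stdSimplex.map ι q' = p := by
    refine stdSimplex.ext (funext fun i => ?_)
    rw [stdSimplex.map_coe, FunOnFinite.linearMap_apply_apply, Finset.sum_filter]
    change ∑ j, (if ι j = i then p (ι j) else 0) = p i
    rw [hmap fun j => if j = i then p j else 0, Finset.sum_ite_eq']
    split_ifs with h
    · rfl
    · by_contra h'
      exact h (by simp [I, Ne.symm h'])
  have hθ : ∀ j, ∃ r, (W r).1 = (σ.chain (ι j)).1 := fun j =>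
    (hs _).1 ((σ.mem_support_weight p _).2 ⟨ι j, hι j, rfl⟩)
  choose θ hθ using hθ
  have hθW : ∀ j, W (θ j) = σ.chain (ι j) := fun j => Subtype.ext (hθ j)
  let Θ : Fin (l + 1) →o Fin (m + 1) := ⟨θ, fun i j hij => by
    rw [← hW.le_iff_ge, hθW, hθW]
    exact σ.anti (ι.monotone hij)⟩
  have hW0 : (W 0).1 ≤ (σ.chain 0).1 := by
    obtain ⟨i, -, hi⟩ := (σ.mem_support_weight p _).1 ((hs _).2 ⟨0, rfl⟩)
    rw [← hi]
    exact σ.anti (Fin.zero_le i)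
  -- `W 0` may be smaller than `V₀`, since leading coordinates may vanish; the embedding is
  -- restricted accordingly.
  let τ : BarSimplex α U U' m :=
    { chain := W
      anti := hW.antitone
      emb := σ.emb.comp (LinearIsometry.withLpProdMap 2 LinearIsometry.id (inclusion hW0)) }
  refine ⟨τ, stdSimplex.map θ q', rfl, ?_⟩
  have h1 := Quot.sound (RealizationRel.glue ι.toOrderHom σ q')
  have h2 := Quot.sound (RealizationRel.glue Θ τ q')
  have h3 : σ.reindex ι.toOrderHom = τ.reindex Θ :=
    ext' (funext fun j => (hθW j).symm) fun x y _ _ => rfl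
  rw [h3] at h1
  have h4 : stdSimplex.map ι.toOrderHom q' = p := hq'
  rw [h4] at h1
  exact h1.symm.trans h2

end BarSimplex

namespace Hocolim

variable {α : OrthRep.{v} Γ} {U U' U₁ U₂ U₁' U₂' : OrthRep.{u} Γ}

/-- Equal operators have equal weights, so both points can be represented on one strictly decreasing
chain. There the coordinates are values of the weight, and the embedding is known on `U` and on
`range S ⊇ V₀`. -/
theorem eq_of_toMor_eq_of_op_eq {x y : Hocolim α U U'} (h₁ : x.toMor = y.toMor)
    (h₂ : x.op = y.op) : x = y := by
  classical
  obtain ⟨k, σ, p⟩ := x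
  obtain ⟨k', σ', p'⟩ := y
  obtain ⟨m, W, hW, hs⟩ := σ.exists_chain p
  obtain ⟨τ, q, hτ, hτq⟩ := σ.exists_mk_eq p W hW hs
  obtain ⟨τ', q', hτ', hτq'⟩ := σ'.exists_mk_eq p' W hW
    (by rw [← BarSimplex.weight_eq_of_op_eq σ p σ' p' h₂]; exact hs)
  have e₂ : τ.op q = τ'.op q' := by
    have h3 := congrArg op hτq
    have h4 := congrArg op hτq'
    exact h3.symm.trans (h₂.trans h4)
  have e₁ : τ.left = τ'.left := by
    rw [← toMor_mk τ q, ← toMor_mk τ' q', ← hτq, ← hτq']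
    exact congrArg _ h₁
  change Quot.mk _ _ = Quot.mk _ _
  rw [hτq, hτq']
  have hw := BarSimplex.weight_eq_of_op_eq τ q τ' q' e₂
  have hqi : ∀ (ρ : BarSimplex α U U' m) (r : stdSimplex ℝ (Fin (m + 1))), ρ.chain = W →
      ∀ i, ρ.weight r (W i).1 = r i := by
    intro ρ r hρ i
    rw [BarSimplex.weight_apply, Finset.sum_eq_single i]
    · rw [hρ, if_pos rfl]
    · intro j _ hji
      rw [hρ, if_neg]
      exact fun h => hji (hW.injective (Subtype.ext h))
    · simp
  have hqq : q = q' := stdSimplex.ext (funext fun i => by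
    rw [← hqi τ q hτ i, ← hqi τ' q' hτ' i, hw])
  have hchain : τ.chain = τ'.chain := hτ.trans hτ'.symm
  -- Without a positive coordinate at the first vertex the operator would not determine the
  -- embedding on all of `V₀`.
  have hsupp : (τ.chain 0).1 ∈ (τ.weight q).support := by
    have h5 : op (Quot.mk _ ⟨k, σ, p⟩) = op (Quot.mk _ ⟨m, τ, q⟩) := congrArg op hτq
    rw [← BarSimplex.weight_eq_of_op_eq σ p τ q h5, hs, hτ]
    exact ⟨0, rfl⟩
  have hτeq : τ = τ' := by
    refine BarSimplex.ext' hchain fun x y h3 h4 => ?_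
    rw [BarSimplex.emb_apply, BarSimplex.emb_apply, e₁]
    obtain ⟨z, hz⟩ := le_range_weightOp (τ.weight_nonneg q) hsupp h3
    rw [BarSimplex.weightOp_weight] at hz
    have h6 : τ'.flagOp q' z = y := by
      rw [← BarSimplex.flagOp_eq_of_op_eq τ q τ' q' e₂]; exact hz
    have h7 := DFunLike.congr_fun e₂ z
    rw [BarSimplex.op_apply, BarSimplex.op_apply, h6] at h7
    rw [← h7]
    exact congrArg (fun t => τ'.left x + τ.right t) hz.symm
  rw [hτeq, hqq]

theorem toSphere_injective :
    Function.Injective (toSphere : Hocolim α U U' → SphereBundle α U U') := by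
  intro x y h
  refine eq_of_toMor_eq_of_op_eq (congrArg SphereBundle.proj h) ?_
  have hv : ‖x.tensor‖⁻¹ • x.tensor = ‖y.tensor‖⁻¹ • y.tensor :=
    congrArg (fun z : SphereBundle α U U' => z.1.vec) h
  have hop := congrArg (tensorHom α U') hv
  rw [_root_.map_smul, _root_.map_smul, tensorHom_tensor, tensorHom_tensor] at hop
  -- Both operators have operator norm one, so the two rescaling factors agree.
  have hn := congrArg norm hop
  rw [norm_smul, norm_smul, norm_op, norm_op, norm_inv, norm_inv, norm_norm, norm_norm, mul_one,
    mul_one] at hn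
  rw [← hn] at hop
  exact smul_right_injective _ (inv_ne_zero (norm_ne_zero_iff.2 (tensor_ne_zero x))) hop

theorem toSphere_surjective :
    Function.Surjective (toSphere : Hocolim α U U' → SphereBundle α U U') := by
  intro s
  set A := tensorHom α U' s.1.vec
  have hv0 : s.1.vec ≠ 0 := fun h => by
    have := s.2
    rw [h, norm_zero] at this
    exact zero_ne_one this
  have hA0 : A ≠ 0 := fun h => hv0 ((tensorHom α U').map_eq_zero_iff.1 h)
  have hAmem : ∀ y, A y ∈ (LinearMap.range s.proj.toLinearMap)ᗮ :=
    (mem_range_lTensor_iff _ _).1 s.1.2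
  obtain ⟨k, V, p, B, hV, hVne, hp, hAB, hB, hBA⟩ := exists_flag_decomposition A hA0
  have hc0 : 0 ≤ ∑ i, p i := Finset.sum_nonneg fun i _ => hp i
  have hc : ∑ i, p i ≠ 0 := by
    intro h
    rw [Finset.sum_eq_zero_iff_of_nonneg fun i _ => hp i] at h
    apply hA0
    ext x
    rw [hAB, Finset.sum_eq_zero fun i hi => by rw [h i hi, zero_smul], _root_.map_zero]
    rfl
  -- Dividing by `c` turns the weights into barycentric coordinates; the factor disappears again
  -- under the rescaling to tensor norm one.
  set c := ∑ i, p i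
  let q : stdSimplex ℝ (Fin (k + 1)) := ⟨fun i => c⁻¹ * p i,
    fun i => mul_nonneg (inv_nonneg.2 hc0) (hp i), by
      rw [← Finset.mul_sum]; exact inv_mul_cancel₀ hc⟩
  -- On `V 0` the values of `B` are values of `A`, hence orthogonal to the image of `f`. So `f` and
  -- `B` combine to an isometric embedding of `U ⊕ V 0`.
  have horth : ∀ (x : U) (y : α), y ∈ V 0 → inner ℝ (s.proj x) (B y) = 0 := by
    intro x y hy
    obtain ⟨z, hz⟩ := hBA y hy
    rw [hz]
    exact (Submodule.mem_orthogonal _ _).1 (hAmem z) _ ⟨x, rfl⟩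
  let g : WithLp 2 (U × V 0) →ₗᵢ[ℝ] U' :=
    { toLinearMap := (s.proj.toLinearMap.coprod (B.toLinearMap ∘ₗ (V 0).subtype)) ∘ₗ
        (WithLp.linearEquiv 2 ℝ (U × V 0)).toLinearMap
      norm_map' := fun z => by
        change ‖s.proj z.fst + B z.snd‖ = ‖z‖
        rw [← sq_eq_sq₀ (norm_nonneg _) (norm_nonneg _), WithLp.prod_norm_sq_eq_of_L2,
          norm_add_sq_real, horth _ _ z.snd.2, hB _ z.snd.2, LinearIsometry.norm_map]
        simp }
  let σ : BarSimplex α U U' k :=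
    { chain := fun i => ⟨V i, hVne i⟩
      anti := hV
      emb := g }
  have hg : ∀ (x : U) (y : V 0), g (WithLp.toLp 2 (x, y)) = s.proj x + B y := fun _ _ => rfl
  have hop : σ.op q = c⁻¹ • A := by
    ext y
    rw [BarSimplex.op_apply, BarSimplex.right_apply _ (σ.flagOp_mem q y)]
    refine (hg _ _).trans ?_
    rw [_root_.map_zero, zero_add, smul_apply, hAB, ← _root_.map_smul, Finset.smul_sum]
    change B (σ.flagOp q y) = _
    rw [BarSimplex.flagOp_apply]
    congr 1
    exact Finset.sum_congr rfl fun i _ => mul_smul _ _ _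
  obtain ⟨x, hxm, hx⟩ : ∃ x : Hocolim α U U', x.toMor = s.proj ∧ x.op = c⁻¹ • A := by
    refine ⟨Quot.mk _ ⟨k, σ, q⟩, ?_, hop⟩
    ext x
    refine (hg x 0).trans ?_
    simp only [ZeroMemClass.coe_zero, _root_.map_zero, add_zero]
  have ht : x.tensor = c⁻¹ • s.1.vec := by
    apply (tensorHom α U').injective
    rw [tensorHom_tensor, _root_.map_smul, hx]
  refine ⟨x, Subtype.ext (Bundle.ext hxm ?_)⟩
  rw [toSphere_vec, ht, norm_smul, s.2, Real.norm_of_nonneg (inv_nonneg.2 hc0), mul_one, inv_inv,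
    smul_smul, mul_inv_cancel₀ hc, one_smul]

end Hocolim

/-! ### Compactness of the spaces of embeddings and of simplices -/

section Isometries

variable {E : Type u} {F : Type v} [NormedAddCommGroup E] [InnerProductSpace ℝ E]
  [NormedAddCommGroup F] [InnerProductSpace ℝ F]

theorem isInducing_toContinuousLinearMap : Topology.IsInducing
    (LinearIsometry.toContinuousLinearMap : (E →ₗᵢ[ℝ] F) → E →L[ℝ] F) := ⟨rfl⟩

instance : T2Space (E →ₗᵢ[ℝ] F) :=
  (Topology.IsEmbedding.mk isInducing_toContinuousLinearMap
    LinearIsometry.toContinuousLinearMap_injective).t2Space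

instance [FiniteDimensional ℝ E] [FiniteDimensional ℝ F] : CompactSpace (E →ₗᵢ[ℝ] F) := by
  rw [← isCompact_univ_iff, isInducing_toContinuousLinearMap.isCompact_iff, Set.image_univ]
  have hr : Set.range (LinearIsometry.toContinuousLinearMap : (E →ₗᵢ[ℝ] F) → E →L[ℝ] F) =
      {f | ∀ x, ‖f x‖ = ‖x‖} := by
    ext f
    constructor
    · rintro ⟨g, rfl⟩ x
      exact g.norm_map x
    · intro h
      exact ⟨⟨f.toLinearMap, h⟩, rfl⟩
  rw [hr]
  have : ProperSpace (E →L[ℝ] F) := FiniteDimensional.proper_real _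
  refine (isCompact_closedBall (0 : E →L[ℝ] F) 1).of_isClosed_subset ?_ fun f hf => ?_
  · rw [Set.ofPred_forall]
    exact isClosed_iInter fun x => isClosed_eq (by fun_prop) continuous_const
  · rw [mem_closedBall_zero_iff]
    exact ContinuousLinearMap.opNorm_le_bound _ zero_le_one fun x => by rw [hf x, one_mul]

end Isometries

namespace BarSimplex

variable {α : OrthRep.{v} Γ} {U U' : OrthRep.{u} Γ} {k m : ℕ}

/-- All conditions are closed. Norm one encodes that `V i` is nonzero, `P i * P j = P j` encodes `V
j ≤ V i`, and the last two say that the operator factors through `P 0` and is isometric on `U ⊕ V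
0`. -/
theorem range_code : Set.range (code : BarSimplex α U U' k → _) =
    {x | (∀ i, x.1 i * x.1 i = x.1 i) ∧ (∀ i, star (x.1 i) = x.1 i) ∧ (∀ i, ‖x.1 i‖ = 1) ∧
      (∀ i j, i ≤ j → x.1 i * x.1 j = x.1 j) ∧
      (∀ (u : U) (y : α), x.2 (WithLp.toLp 2 (u, y)) = x.2 (WithLp.toLp 2 (u, x.1 0 y))) ∧
      ∀ (u : U) (y : α), ‖x.2 (WithLp.toLp 2 (u, x.1 0 y))‖ ^ 2 = ‖u‖ ^ 2 + ‖x.1 0 y‖ ^ 2} := by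
  ext ⟨P, e⟩
  constructor
  · rintro ⟨σ, hσ⟩
    obtain ⟨rfl, rfl⟩ := Prod.ext_iff.1 hσ
    have hpr : ∀ y, (σ.chain 0).1.orthogonalProjectionOnto ((σ.chain 0).1.starProjection y) =
        (σ.chain 0).1.orthogonalProjectionOnto y := fun y =>
      orthogonalProjectionOnto_eq (Submodule.starProjection_apply_mem _ y)
    refine ⟨fun i => (σ.chain i).1.isIdempotentElem_starProjection,
      fun i => isStarProjection_starProjection.isSelfAdjoint,
      fun i => Submodule.norm_starProjection _ (σ.chain i).2,
      fun i j hij => ?_, fun u y => ?_, fun u y => ?_⟩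
    · ext y
      exact Submodule.starProjection_eq_self_iff.2
        (σ.anti hij (Submodule.starProjection_apply_mem _ _))
    · change σ.emb _ = σ.emb (WithLp.toLp 2 (u, (σ.chain 0).1.orthogonalProjectionOnto
        ((σ.chain 0).1.starProjection y)))
      rw [hpr]
      rfl
    · change ‖σ.emb (WithLp.toLp 2 (u, (σ.chain 0).1.orthogonalProjectionOnto
        ((σ.chain 0).1.starProjection y)))‖ ^ 2 = _
      rw [hpr, LinearIsometry.norm_map, WithLp.prod_norm_sq_eq_of_L2]
      rfl
  · rintro ⟨h1, h2, h3, h4, h5, h6⟩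
    dsimp only at h1 h2 h3 h4 h5 h6
    have hP : ∀ i, ∃ V : Submodule ℝ α, P i = V.starProjection := fun i => by
      obtain ⟨V, _, hV⟩ := isStarProjection_iff_eq_starProjection.1 ⟨h1 i, h2 i⟩
      exact ⟨V, hV⟩
    choose V hV using hP
    obtain rfl : P = fun i => (V i).starProjection := funext hV
    have hp : ∀ y : V 0, (V 0).starProjection y = y := fun y =>
      Submodule.starProjection_eq_self_iff.2 y.2
    let g : WithLp 2 (U × V 0) →ₗᵢ[ℝ] U' :=
      { toFun := fun z => e (WithLp.toLp 2 (z.fst, (z.snd : α)))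
        map_add' := fun z z' => by rw [← _root_.map_add]; rfl
        map_smul' := fun c z => by rw [← _root_.map_smul]; rfl
        norm_map' := fun z => by
          change ‖e (WithLp.toLp 2 (z.fst, (z.snd : α)))‖ = ‖z‖
          rw [← sq_eq_sq₀ (norm_nonneg _) (norm_nonneg _), WithLp.prod_norm_sq_eq_of_L2, h5, h6,
            hp]
          rfl }
    refine ⟨⟨fun i => ⟨V i, fun h => ?_⟩, fun i j hij x hx => ?_, g⟩, Prod.ext rfl ?_⟩
    · have h7 : ‖(V i).starProjection‖ = 1 := h3 i
      rw [h, Submodule.starProjection_bot, norm_zero] at h7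
      exact zero_ne_one h7
    · have h7 := DFunLike.congr_fun (h4 i j hij) x
      change (V i).starProjection ((V j).starProjection x) = (V j).starProjection x at h7
      rw [Submodule.starProjection_eq_self_iff.2 hx] at h7
      exact Submodule.starProjection_eq_self_iff.1 h7
    · ext z
      exact (h5 z.fst z.snd).symm

instance : CompactSpace (BarSimplex α U U' k) := by
  have hind : Topology.IsInducing (code : BarSimplex α U U' k → _) := ⟨rfl⟩
  rw [← isCompact_univ_iff, hind.isCompact_iff, Set.image_univ, range_code]
  have : ProperSpace (α →L[ℝ] α) := FiniteDimensional.proper_real _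
  have : ProperSpace (WithLp 2 (U × α) →L[ℝ] U') :=
    FiniteDimensional.proper_real (WithLp 2 (U × α) →L[ℝ] U')
  have hK₁ : IsCompact (Metric.closedBall (0 : Fin (k + 1) → (α →L[ℝ] α)) 1) :=
    isCompact_closedBall _ _
  have hK₂ : IsCompact (Metric.closedBall (0 : WithLp 2 (U × α) →L[ℝ] U') 1) :=
    isCompact_closedBall _ _
  have hK := hK₁.prod hK₂
  refine IsCompact.of_isClosed_subset hK ?_ ?_
  · simp only [Set.ofPred_and, Set.ofPred_forall]
    refine IsClosed.inter ?_ (IsClosed.inter ?_ (IsClosed.inter ?_ (IsClosed.inter ?_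
      (IsClosed.inter ?_ ?_))))
    · exact isClosed_iInter fun i => isClosed_eq (by fun_prop) (by fun_prop)
    · exact isClosed_iInter fun i => isClosed_eq (by fun_prop) (by fun_prop)
    · exact isClosed_iInter fun i => isClosed_eq (by fun_prop) (by fun_prop)
    · exact isClosed_iInter fun i => isClosed_iInter fun j => isClosed_iInter fun _ =>
        isClosed_eq (by fun_prop) (by fun_prop)
    · exact isClosed_iInter fun u => isClosed_iInter fun y =>
        isClosed_eq (by fun_prop) (by fun_prop)
    · exact isClosed_iInter fun u => isClosed_iInter fun y =>
        isClosed_eq (by fun_prop) (by fun_prop)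
  · rintro ⟨P, e⟩ ⟨-, -, h3, -, h5, h6⟩
    dsimp only at h3 h5 h6
    refine ⟨mem_closedBall_zero_iff.2
      ((pi_norm_le_iff_of_nonneg zero_le_one).2 fun i => (h3 i).le),
      (mem_closedBall_zero_iff (E := WithLp 2 (U × α) →L[ℝ] U')).2
      (ContinuousLinearMap.opNorm_le_bound _ zero_le_one fun z => ?_)⟩
    rw [one_mul, ← sq_le_sq₀ (norm_nonneg _) (norm_nonneg _), WithLp.prod_norm_sq_eq_of_L2]
    change ‖e (WithLp.toLp 2 (z.fst, z.snd))‖ ^ 2 ≤ _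
    rw [h5, h6]
    have h8 : ‖P 0 z.snd‖ ≤ ‖z.snd‖ := by
      have := (P 0).le_opNorm z.snd
      rwa [h3, one_mul] at this
    gcongr

end BarSimplex

namespace Bundle

variable {α : OrthRep.{v} Γ} {U U' : OrthRep.{u} Γ}

instance : T2Space (Bundle α U U') :=
  inferInstanceAs (T2Space {x : Mor U U' × (α ⊗[ℝ] U') //
    x.2 ∈ LinearMap.range (LinearMap.lTensor α (LinearMap.range x.1.toLinearMap)ᗮ.subtype)})

theorem continuous_proj : Continuous (proj : Bundle α U U' → Mor U U') :=
  continuous_fst.comp continuous_subtype_val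

theorem continuous_vec : Continuous (vec : Bundle α U U' → α ⊗[ℝ] U') :=
  continuous_snd.comp continuous_subtype_val

theorem mem_iff (f : Mor U U') (v : α ⊗[ℝ] U') :
    v ∈ LinearMap.range (LinearMap.lTensor α (LinearMap.range f.toLinearMap)ᗮ.subtype) ↔
      ∀ (y : α) (x : U), inner ℝ (f x) (tensorHom α U' v y) = 0 := by
  rw [mem_range_lTensor_iff]
  refine forall_congr' fun y => ?_
  rw [Submodule.mem_orthogonal]
  exact ⟨fun h x => h _ ⟨x, rfl⟩, by rintro h _ ⟨x, rfl⟩; exact h x⟩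

/-- The fibre condition is a family of equations `⟪f x, A y⟫ = 0`. Closedness makes the total space
locally compact, and with it the one-point compactification Hausdorff. -/
theorem isClosed_carrier : IsClosed {x : Mor U U' × (α ⊗[ℝ] U') |
    x.2 ∈ LinearMap.range (LinearMap.lTensor α (LinearMap.range x.1.toLinearMap)ᗮ.subtype)} := by
  simp only [mem_iff, Set.ofPred_forall]
  refine isClosed_iInter fun y => isClosed_iInter fun x => isClosed_eq ?_ continuous_const
  have h1 : Continuous fun z : Mor U U' × (α ⊗[ℝ] U') => z.1.toContinuousLinearMap x :=
    (isInducing_toContinuousLinearMap.continuous.comp continuous_fst).clm_apply continuous_const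
  have h2 : Continuous fun z : Mor U U' × (α ⊗[ℝ] U') => tensorHom α U' z.2 y :=
    ((LinearMap.continuous_of_finiteDimensional (tensorHom α U').toLinearMap).comp
      continuous_snd).clm_apply continuous_const
  exact h1.inner h2

instance : LocallyCompactSpace (Bundle α U U') := by
  have : ProperSpace (α ⊗[ℝ] U') := FiniteDimensional.proper_real _
  exact isClosed_carrier.isClosedEmbedding_subtypeVal.locallyCompactSpace

end Bundle

instance {α : OrthRep.{v} Γ} {U U' : OrthRep.{u} Γ} : T2Space (SphereBundle α U U') :=
  inferInstanceAs (T2Space {x : Bundle α U U' // ‖x.vec‖ = 1})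

instance {α : OrthRep.{v} Γ} {U U' : OrthRep.{u} Γ} : T2Space (Thom α U U') :=
  inferInstanceAs (T2Space (OnePoint (Bundle α U U')))

/-! ### Compactness of the homotopy colimit and the sphere bundle homeomorphism -/

namespace Hocolim

variable {α : OrthRep.{v} Γ} {U U' : OrthRep.{u} Γ}

theorem le_finrank_of_strictAnti {m : ℕ} {W : Fin (m + 1) → NZSub α} (hW : StrictAnti W) :
    m ≤ Module.finrank ℝ α := by
  have hinj : Function.Injective fun i => Module.finrank ℝ (W i).1 :=
    StrictAnti.injective fun i j hij => Submodule.finrank_lt_finrank_of_lt (hW hij)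
  have h := Finset.card_le_card (s := Finset.univ.image fun i => Module.finrank ℝ (W i).1)
    (t := Finset.range (Module.finrank ℝ α + 1)) fun n hn => by
      obtain ⟨i, -, rfl⟩ := Finset.mem_image.1 hn
      exact Finset.mem_range.2 (Nat.lt_succ_of_le (Submodule.finrank_le _))
  rw [Finset.card_image_of_injective _ hinj, Finset.card_univ, Fintype.card_fin,
    Finset.card_range] at h
  omega

/-- Every point is represented on a strictly decreasing chain, whose length is bounded by the
dimension of `α`. So finitely many compact spaces of simplices cover the quotient. -/
instance : CompactSpace (Hocolim α U U') := by
  let q : ∀ k, BarSimplex α U U' k × stdSimplex ℝ (Fin (k + 1)) → Hocolim α U U' :=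
    fun k x => Quot.mk _ ⟨k, x⟩
  have hq : ∀ k, Continuous (q k) := fun k => continuous_quot_mk.comp continuous_sigmaMk
  have huniv : (Set.univ : Set (Hocolim α U U')) =
      ⋃ k ∈ Finset.range (Module.finrank ℝ α + 1), Set.range (q k) := by
    refine (Set.eq_univ_of_forall fun x => ?_).symm
    obtain ⟨k, σ, p⟩ := x
    obtain ⟨m, W, hW, hs⟩ := σ.exists_chain p
    obtain ⟨τ, r, -, hτ⟩ := σ.exists_mk_eq p W hW hs
    refine Set.mem_biUnion (Finset.mem_coe.2 (Finset.mem_range.2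
      (Nat.lt_succ_of_le (le_finrank_of_strictAnti hW)))) ⟨(τ, r), hτ.symm⟩
  rw [← isCompact_univ_iff, huniv]
  exact Finset.isCompact_biUnion _ fun k _ => isCompact_range (hq k)

/-- The homotopy colimit is homeomorphic to the sphere bundle. -/
def sphereHomeo (α : OrthRep.{v} Γ) (U U' : OrthRep.{u} Γ) :
    Hocolim α U U' ≃ₜ SphereBundle α U U' :=
  Continuous.homeoOfEquivCompactToT2
    (f := Equiv.ofBijective toSphere ⟨toSphere_injective, toSphere_surjective⟩)
    continuous_toSphere

theorem sphereHomeo_apply (x : Hocolim α U U') : sphereHomeo α U U' x = x.toSphere := rfl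

end Hocolim

/-! ### The mapping cone and the Thom space -/

namespace Bundle

variable {α : OrthRep.{v} Γ} {U U' U₁ U₂ U₁' U₂' : OrthRep.{u} Γ}

/-- Fibrewise scalar multiplication. -/
def scale (s : ℝ) (x : Bundle α U U') : Bundle α U U' :=
  ⟨(x.proj, s • x.vec), Submodule.smul_mem _ _ x.2⟩

theorem scale_vec (s : ℝ) (x : Bundle α U U') : (scale s x).vec = s • x.vec := rfl

theorem continuous_scale : Continuous fun z : ℝ × Bundle α U U' => scale z.1 z.2 :=
  Continuous.subtype_mk ((continuous_proj.comp continuous_snd).prodMk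
    (continuous_fst.smul (continuous_vec.comp continuous_snd))) _

theorem continuous_zero : Continuous (zero : Mor U U' → Bundle α U U') :=
  Continuous.subtype_mk (continuous_id.prodMk continuous_const) _

theorem mapAux_scale (a : α ≃ₗᵢ[ℝ] α) (i : Mor U₂ U₁) (j : Mor U₁' U₂') (s : ℝ)
    (x : Bundle α U₁ U₁') : mapAux a i j (scale s x) = scale s (mapAux a i j x) :=
  ext rfl (_root_.map_smul _ _ _)

theorem mapAux_zero (a : α ≃ₗᵢ[ℝ] α) (i : Mor U₂ U₁) (j : Mor U₁' U₂') (f : Mor U₁ U₁') :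
    mapAux a i j (zero f : Bundle α U₁ U₁') = zero (Mor.map i j f) :=
  ext rfl (_root_.map_zero _)

/-- The point of the unit sphere in direction of a nonzero vector. -/
def normalize (x : Bundle α U U') (hx : x.vec ≠ 0) : SphereBundle α U U' :=
  ⟨scale ‖x.vec‖⁻¹ x, by
    rw [scale_vec, _root_.norm_smul, norm_inv, norm_norm, inv_mul_cancel₀ (norm_ne_zero_iff.2 hx)]⟩

theorem scale_normalize (x : Bundle α U U') (hx : x.vec ≠ 0) :
    scale ‖x.vec‖ (normalize x hx).1 = x := by
  refine ext rfl ?_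
  change ‖x.vec‖ • (‖x.vec‖⁻¹ • x.vec) = x.vec
  rw [smul_smul, mul_inv_cancel₀ (norm_ne_zero_iff.2 hx), one_smul]

end Bundle

/-- The radius `(1 - t) / t` corresponding to the cone coordinate `t`. -/
def radius (t : unitInterval) : ℝ := (1 - t) / t

theorem radius_nonneg (t : unitInterval) : 0 ≤ radius t :=
  div_nonneg (sub_nonneg.2 t.2.2) t.2.1

theorem radius_one : radius 1 = 0 := by simp [radius]

theorem radius_eq_zero_iff {t : unitInterval} (ht : t ≠ 0) : radius t = 0 ↔ t = 1 := by
  have h : (t : ℝ) ≠ 0 := fun h => ht (Subtype.ext h)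
  rw [radius, div_eq_zero_iff, or_iff_left h, sub_eq_zero, eq_comm]
  exact ⟨fun h => Subtype.ext h, fun h => congrArg Subtype.val h⟩

/-- The cone coordinate `1 / (1 + r)` corresponding to the radius `r`. -/
def coneCoord (r : ℝ) (hr : 0 ≤ r) : unitInterval :=
  ⟨(1 + r)⁻¹, inv_nonneg.2 (by positivity), inv_le_one_of_one_le₀ (by linarith)⟩

theorem coneCoord_ne_zero (r : ℝ) (hr : 0 ≤ r) : coneCoord r hr ≠ 0 := fun h => by
  have h1 : (1 + r)⁻¹ = 0 := congrArg Subtype.val h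
  have : 1 + r ≠ 0 := by positivity
  exact inv_ne_zero this h1

theorem radius_coneCoord (r : ℝ) (hr : 0 ≤ r) : radius (coneCoord r hr) = r := by
  have : 1 + r ≠ 0 := by positivity
  change (1 - (1 + r)⁻¹) / (1 + r)⁻¹ = r
  field_simp
  ring

theorem coneCoord_radius {t : unitInterval} (ht : t ≠ 0) :
    coneCoord (radius t) (radius_nonneg t) = t := by
  have h : (t : ℝ) ≠ 0 := fun h => ht (Subtype.ext h)
  refine Subtype.ext ?_
  change (1 + (1 - (t : ℝ)) / t)⁻¹ = t
  field_simp
  ring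

theorem continuousAt_radius {t : unitInterval} (ht : t ≠ 0) : ContinuousAt radius t :=
  (continuousAt_const.sub continuous_subtype_val.continuousAt).div
    continuous_subtype_val.continuousAt fun h => ht (Subtype.ext h)

namespace SphereBundle

variable {α : OrthRep.{v} Γ} {U U' U₁ U₂ U₁' U₂' : OrthRep.{u} Γ}

open Classical in
/-- The map from the cylinder on the sphere bundle to the Thom space. -/
def toThom (x : SphereBundle α U U' × unitInterval) : Thom α U U' :=
  if x.2 = 0 then Thom.pt else OnePoint.some (Bundle.scale (radius x.2) x.1.1)

theorem toThom_zero (x : SphereBundle α U U') : toThom (x, 0) = Thom.pt := if_pos rfl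

theorem toThom_of_ne (x : SphereBundle α U U') {t : unitInterval} (ht : t ≠ 0) :
    toThom (x, t) = OnePoint.some (Bundle.scale (radius t) x.1) := if_neg ht

theorem toThom_one (x : SphereBundle α U U') : toThom (x, 1) = Thom.zero x.proj := by
  rw [toThom_of_ne x one_ne_zero, radius_one]
  exact congrArg OnePoint.some (Bundle.ext rfl (zero_smul _ _))

theorem continuous_toThom :
    Continuous (toThom : SphereBundle α U U' × unitInterval → Thom α U U') := by
  rw [continuous_iff_continuousAt]
  rintro ⟨x, t⟩
  by_cases ht : t = 0
  · subst ht
    rw [ContinuousAt, toThom_zero]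
    refine OnePoint.le_nhds_infty.2 fun K _ hK => ?_
    -- Vectors in a compact set have norm at most some `M`, while `(1 - t) / t > M` as soon as `t (M
    -- + 1) < 1`.
    obtain ⟨M, hM⟩ := hK.bddAbove_image (Bundle.continuous_vec.norm.continuousOn)
    have hev : ∀ᶠ z : SphereBundle α U U' × unitInterval in nhds (x, 0), (z.2 : ℝ) * (M + 1) < 1 :=
      (show Continuous fun z : SphereBundle α U U' × unitInterval => (z.2 : ℝ) * (M + 1) by
        fun_prop).continuousAt.eventually_lt continuousAt_const (by simp)
    change ∀ᶠ z in nhds (x, 0), z ∈ toThom ⁻¹'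
      (OnePoint.some '' Kᶜ ∪ {OnePoint.infty} : Set (OnePoint (Bundle α U U')))
    filter_upwards [hev] with z hz
    obtain ⟨y, t⟩ := z
    by_cases ht : t = 0
    · subst ht
      exact Or.inr (toThom_zero y)
    · refine Or.inl ⟨Bundle.scale (radius t) y.1, fun hmem => ?_, (toThom_of_ne y ht).symm⟩
      have h1 : ‖(Bundle.scale (radius t) y.1).vec‖ ≤ M := hM ⟨_, hmem, rfl⟩
      have htp : (0 : ℝ) < t := lt_of_le_of_ne t.2.1 fun h => ht (Subtype.ext h.symm)
      rw [Bundle.scale_vec, norm_smul, y.2, mul_one, Real.norm_of_nonneg (radius_nonneg t), radius,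
        div_le_iff₀ htp] at h1
      dsimp only at hz
      linarith
  · have h1 : ∀ᶠ z : SphereBundle α U U' × unitInterval in nhds (x, t), z.2 ≠ 0 :=
      continuous_snd.continuousAt.eventually_ne ht
    have h2 : ContinuousAt (fun z : SphereBundle α U U' × unitInterval =>
        (OnePoint.some (Bundle.scale (radius z.2) z.1.1) : OnePoint (Bundle α U U'))) (x, t) := by
      refine OnePoint.continuous_coe.continuousAt.comp ?_
      refine ContinuousAt.comp (g := fun z : ℝ × Bundle α U U' => Bundle.scale z.1 z.2)
        (f := fun z : SphereBundle α U U' × unitInterval => (radius z.2, z.1.1))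
        Bundle.continuous_scale.continuousAt ?_
      exact (ContinuousAt.comp (f := Prod.snd) (continuousAt_radius ht)
        continuous_snd.continuousAt).prodMk
        (continuous_subtype_val.comp continuous_fst).continuousAt
    exact h2.congr (h1.mono fun z hz => (toThom_of_ne z.1 hz).symm)

end SphereBundle

namespace StiefelCofiber

variable {α : OrthRep.{v} Γ} {U U' U₁ U₂ U₁' U₂' : OrthRep.{u} Γ}

/-- The point of the mapping cone with cone coordinate `t`. -/
def cyl (x : Hocolim α U U') (t : unitInterval) : StiefelCofiber α U U' :=
  Quot.mk _ (.inr (.inl (x, t)))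

theorem cyl_zero (x : Hocolim α U U') : cyl x 0 = pt := Quot.sound (ConeRel.apex x)

theorem cyl_one (x : Hocolim α U U') : cyl x 1 = incl x.toMor := Quot.sound (ConeRel.base x)

theorem cases {P : StiefelCofiber α U U' → Prop} (h₁ : P pt) (h₂ : ∀ x t, P (cyl x t))
    (h₃ : ∀ f, P (incl f)) (z : StiefelCofiber α U U') : P z := by
  obtain ⟨_ | ⟨x, t⟩ | f⟩ := z
  · exact h₁
  · exact h₂ x t
  · exact h₃ f

/-- The comparison map from the mapping cone to the Thom space. -/
def toThom : StiefelCofiber α U U' → Thom α U U' :=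
  Quot.lift (Sum.elim (fun _ => Thom.pt)
    (Sum.elim (fun z => SphereBundle.toThom (z.1.toSphere, z.2)) Thom.zero)) (by
    rintro _ _ (x | x)
    · exact SphereBundle.toThom_zero x.toSphere
    · exact SphereBundle.toThom_one x.toSphere)

theorem toThom_cyl (x : Hocolim α U U') (t : unitInterval) :
    toThom (cyl x t) = SphereBundle.toThom (x.toSphere, t) := rfl

theorem continuous_toThom : Continuous (toThom : StiefelCofiber α U U' → Thom α U U') := by
  refine continuous_quot_lift _ (continuous_const.sumElim (Continuous.sumElim ?_ ?_))
  · exact SphereBundle.continuous_toThom.comp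
      ((Hocolim.continuous_toSphere.comp continuous_fst).prodMk continuous_snd)
  · exact OnePoint.continuous_coe.comp Bundle.continuous_zero

open Classical in
/-- The inverse of the comparison map. -/
def ofThom : Thom α U U' → StiefelCofiber α U U' :=
  OnePoint.rec pt fun b => if h : b.vec = 0 then incl b.proj else
    cyl ((Hocolim.sphereHomeo α U U').symm (b.normalize h)) (coneCoord ‖b.vec‖ (norm_nonneg _))

theorem ofThom_pt : ofThom (Thom.pt : Thom α U U') = pt := rfl

theorem ofThom_some_of_eq {b : Bundle α U U'} (h : b.vec = 0) :
    ofThom (OnePoint.some b : OnePoint (Bundle α U U')) = incl b.proj := dif_pos h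

theorem ofThom_some_of_ne {b : Bundle α U U'} (h : b.vec ≠ 0) :
    ofThom (OnePoint.some b : OnePoint (Bundle α U U')) =
      cyl ((Hocolim.sphereHomeo α U U').symm (b.normalize h))
        (coneCoord ‖b.vec‖ (norm_nonneg _)) := dif_neg h

/-- The ends `t = 0` and `t = 1` are absorbed by the cone relations; in between, the norm of the
vector returns the radius and its direction the point of the sphere. -/
theorem ofThom_toThom (z : StiefelCofiber α U U') : ofThom (toThom z) = z := by
  induction z using cases with
  | h₁ => rfl
  | h₃ f => exact ofThom_some_of_eq rfl
  | h₂ x t =>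
    rw [toThom_cyl]
    by_cases ht : t = 0
    · subst ht
      rw [SphereBundle.toThom_zero, ofThom_pt, cyl_zero]
    by_cases ht1 : t = 1
    · subst ht1
      rw [SphereBundle.toThom_one, cyl_one]
      exact ofThom_some_of_eq rfl
    rw [SphereBundle.toThom_of_ne _ ht]
    have hr : radius t ≠ 0 := fun h => ht1 ((radius_eq_zero_iff ht).1 h)
    have hn : ‖(Bundle.scale (radius t) x.toSphere.1).vec‖ = radius t := by
      rw [Bundle.scale_vec, norm_smul, x.toSphere.2, mul_one,
        Real.norm_of_nonneg (radius_nonneg t)]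
    have hne : (Bundle.scale (radius t) x.toSphere.1).vec ≠ 0 := fun h => hr (by
      rw [← hn, h, norm_zero])
    refine (ofThom_some_of_ne hne).trans ?_
    congr 1
    · rw [Homeomorph.symm_apply_eq]
      refine Subtype.ext (Bundle.ext rfl ?_)
      change ‖(Bundle.scale (radius t) x.toSphere.1).vec‖⁻¹ • (radius t • x.toSphere.1.vec) =
        x.toSphere.1.vec
      rw [hn, smul_smul, inv_mul_cancel₀ hr, one_smul]
    · simp only [hn, coneCoord_radius ht]

theorem toThom_ofThom (z : Thom α U U') : toThom (ofThom z) = z := by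
  induction z using OnePoint.rec with
  | infty => rfl
  | coe b =>
    by_cases h : b.vec = 0
    · refine (congrArg toThom (ofThom_some_of_eq h)).trans ?_
      exact congrArg OnePoint.some (Bundle.ext rfl h.symm)
    · refine (congrArg toThom (ofThom_some_of_ne h)).trans ?_
      rw [toThom_cyl, SphereBundle.toThom_of_ne _ (coneCoord_ne_zero _ _), radius_coneCoord,
        ← Hocolim.sphereHomeo_apply, Homeomorph.apply_symm_apply, Bundle.scale_normalize]

instance : CompactSpace (StiefelCofiber α U U') :=
  inferInstanceAs (CompactSpace (Quot (ConeRel (Hocolim.toMor : Hocolim α U U' → Mor U U'))))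

/-- The mapping cone is homeomorphic to the Thom space. -/
def thomHomeo (α : OrthRep.{v} Γ) (U U' : OrthRep.{u} Γ) : StiefelCofiber α U U' ≃ₜ Thom α U U' :=
  Continuous.homeoOfEquivCompactToT2
    (f := { toFun := toThom, invFun := ofThom, left_inv := ofThom_toThom,
            right_inv := toThom_ofThom })
    continuous_toThom

/-- Fibrewise scaling commutes with linear maps. Taking `a` to be the action of a group element
gives equivariance, and `a = 1` gives naturality. -/
theorem toThom_cyl_mapAux (a : α ≃ₗᵢ[ℝ] α) (i : Mor U₂ U₁) (j : Mor U₁' U₂')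
    (x : Hocolim α U₁ U₁') (t : unitInterval) :
    toThom (cyl (Hocolim.mapAux a i j x) t) =
      OnePoint.map (Bundle.mapAux a i j) (toThom (cyl x t)) := by
  rw [toThom_cyl, toThom_cyl]
  by_cases ht : t = 0
  · subst ht
    rw [SphereBundle.toThom_zero, SphereBundle.toThom_zero]
    rfl
  · rw [SphereBundle.toThom_of_ne _ ht, SphereBundle.toThom_of_ne _ ht, Hocolim.toSphere_mapAux,
      ← Bundle.mapAux_scale]
    rfl

theorem toThom_incl_map (a : α ≃ₗᵢ[ℝ] α) (i : Mor U₂ U₁) (j : Mor U₁' U₂') (f : Mor U₁ U₁') :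
    toThom (incl (Mor.map i j f) : StiefelCofiber α U₂ U₂') =
      OnePoint.map (Bundle.mapAux a i j) (toThom (incl f)) :=
  congrArg OnePoint.some (Bundle.mapAux_zero a i j f).symm

end StiefelCofiber

end StiefelCombinatorics

end

/-! ### The main theorem -/

open StiefelCombinatorics in
theorem mainTheorem8 {G : Type w} [Group G] [Finite G] (α : OrthRep.{v} G) (H : Subgroup G) :
    (∃ Φ : ∀ U U' : OrthRep.{u} H, StiefelCofiber (α.res H) U U' ≃ₜ Thom (α.res H) U U',
      (∀ (U U' : OrthRep.{u} H) (h : H) (x : StiefelCofiber (α.res H) U U'),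
        Φ U U' (h • x) = h • Φ U U' x) ∧
      (∀ (U₁ U₂ U₁' U₂' : OrthRep.{u} H) (i : Mor U₂ U₁) (j : Mor U₁' U₂')
        (x : StiefelCofiber (α.res H) U₁ U₁'),
        Φ U₂ U₂' (StiefelCofiber.map i j x) = Thom.map i j (Φ U₁ U₁' x)) ∧
      (∀ U U' : OrthRep.{u} H, Φ U U' StiefelCofiber.pt = Thom.pt) ∧
      (∀ (U U' : OrthRep.{u} H) (f : Mor U U'), Φ U U' (StiefelCofiber.incl f) = Thom.zero f)) ∧
    (∃ Ψ : ∀ U U' : OrthRep.{u} H, Hocolim (α.res H) U U' ≃ₜ SphereBundle (α.res H) U U',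
      (∀ (U U' : OrthRep.{u} H) (h : H) (x : Hocolim (α.res H) U U'),
        Ψ U U' (h • x) = h • Ψ U U' x) ∧
      (∀ (U₁ U₂ U₁' U₂' : OrthRep.{u} H) (i : Mor U₂ U₁) (j : Mor U₁' U₂')
        (x : Hocolim (α.res H) U₁ U₁'),
        Ψ U₂ U₂' (Hocolim.map i j x) = SphereBundle.map i j (Ψ U₁ U₁' x)) ∧
      (∀ (U U' : OrthRep.{u} H) (x : Hocolim (α.res H) U U'),
        (Ψ U U' x).proj = x.toMor)) := by
  refine ⟨⟨StiefelCofiber.thomHomeo (α.res H), fun U U' h x => ?_,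
    fun U₁ U₂ U₁' U₂' i j x => ?_, fun _ _ => rfl, fun _ _ _ => rfl⟩,
    ⟨Hocolim.sphereHomeo (α.res H), fun U U' h x => ?_, fun U₁ U₂ U₁' U₂' i j x => ?_,
      fun _ _ _ => rfl⟩⟩
  · induction x using StiefelCofiber.cases with
    | h₁ => rfl
    | h₂ x t => exact StiefelCofiber.toThom_cyl_mapAux _ _ _ x t
    | h₃ f => exact StiefelCofiber.toThom_incl_map _ _ _ f
  · induction x using StiefelCofiber.cases with
    | h₁ => rfl
    | h₂ x t => exact StiefelCofiber.toThom_cyl_mapAux _ _ _ x t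
    | h₃ f => exact StiefelCofiber.toThom_incl_map _ _ _ f
  · exact Subtype.ext (Hocolim.toSphere_mapAux _ _ _ x)
  · exact Subtype.ext (Hocolim.toSphere_mapAux _ _ _ x)
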